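/- **Setting.** Let $G=(V,E)$ be a finite simple graph and $M$ a matching of $G$; a vertex is *free* if no edge of $M$ is incident to it, and $\mathit{mate}(v)$ is the partner of a matched vertex $v$. An *augmenting path* is a simple path joining two distinct free vertices along which non-matching and matching edges alternate; a *sap* is an augmenting path of minimum length. The following nondeterministic search grows a forest $S$ of alternating trees whose nodes are pairwise disjoint sets of vertices. A vertex outside $S$ is *unlabeled*; a vertex of $S$ is *even* (and then has a value $\mathrm{lcp}(v)$) or *odd*; a vertex added to $S$ as odd has a value $\mathrm{lcp}_{\mathrm{odd}}(v)$, which it keeps forever. Odd nodes are single vertices; the even nodes are called *maximal blossoms*, and each has a *base* vertex. In phase $0$ every free vertex $f$ becomes a root, i.e. the even node $\{f\}$ with base $f$ and $\mathrm{lcp}(f)=0$. Phase $\Delta\ge 1$ consists of two parts. 1. *Growth-steps* (only if $\Delta$ is even). As long as there are an even $u$ with $\mathrm{lcp}(u)=\Delta-2$ and an edge $uv$ with $v$ unlabeled, choose such $u,v$; make $v$ an odd child of the node containing $u$ and $\{\mathit{mate}(v)\}$ an even child of $v$ with base $\mathit{mate}(v)$, and set $\mathrm{lcp}_{\mathrm{odd}}(v)=\Delta-1$,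 $\mathrm{lcp}(\mathit{mate}(v))=\Delta$. 2. *Bridge-steps.* As long as there is a non-matching edge $xy$ (a *bridge*) with both endpoints even, in different maximal blossoms, and $\mathrm{lcp}(x)+\mathrm{lcp}(y)=2\Delta-2$, choose one. If $x$ and $y$ lie in different trees, stop: an augmenting path has been found, and $\Delta$ is the *breakthrough phase*. Otherwise let $N$ be the lowest common ancestor of the nodes containing $x$ and $y$; every odd node $z$ on the tree paths from these two nodes to $N$ becomes even with $\mathrm{lcp}(z)=\mathrm{lcp}(x)+1+\mathrm{lcp}(y)-\mathrm{lcp}_{\mathrm{odd}}(z)$, and all nodes on these two paths are merged into one maximal blossom, whose base is the base of $N$. **Lemma.** Consider any execution of this search and a phase $\Delta\ge1$ of it. (a) Suppose that phase $\Delta$ is completed without breakthrough. Let $v$ be an odd node that becomes even in phase $\Delta$, and let $B$ be the maximal blossom containing $v$ at the end of phase $\Delta$. Then there is no even vertex $u\notin B$ adjacent to $v$ with $\mathrm{lcp}_{\mathrm{odd}}(v)=\mathrm{lcp}(u)+1$. In fact, every even neighbour $u\notin B$ of $v$ satisfies $\mathrm{lcp}(u)\ge\mathrm{lcp}_{\mathrm{odd}}(v)+1$.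 (Evenness and the values of $\mathrm{lcp}$ are those at the end of phase $\Delta$.) (b) Suppose that the breakthrough occurs in phase $\Delta$, and let $B$ be a maximal blossom, with base $b$, at the end of phase $\Delta-1$. Then every sap that contains a vertex of $B$ passes through $b$, i.e. $b$ is an endpoint of the sap or the sap uses the matching edge incident to $b$. -/

import Mathlib

/-- A vertex is free with respect to the matching `M` if no edge of `M` is incident to it. -/
def IsFree {V : Type*} {G : SimpleGraph V} (M : G.Subgraph) (v : V) : Prop :=
  ∀ w, ¬ M.Adj v w

/-- A path in `G` that joins two distinct free vertices and along which matching and non-matching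
edges alternate. (Since its endpoints are free, its first and its last edge are non-matching.) -/
structure IsAugmentingPath {V : Type*} {G : SimpleGraph V} (M : G.Subgraph) {s t : V}
    (p : G.Walk s t) : Prop where
  isPath : p.IsPath
  ne : s ≠ t
  free_left : IsFree M s
  free_right : IsFree M t
  alternating : p.edges.IsChain (fun e f => e ∈ M.edgeSet ↔ f ∉ M.edgeSet)

/-- A shortest augmenting path of `G` with respect to `M`. -/
structure IsShortestAugmentingPath {V : Type*} {G : SimpleGraph V} (M : G.Subgraph) {s t : V}
    (p : G.Walk s t) : Prop where
  isAugmentingPath : IsAugmentingPath M p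
  shortest : ∀ (s' t' : V) (q : G.Walk s' t'), IsAugmentingPath M q → p.length ≤ q.length

/-- The state of the search structures.

* `lcp v` is the value of lcp at `v`, defined exactly when `v` is even;
* `lcpOdd v` is the value of lcp_odd at `v`, defined exactly when `v` was born odd;
* `base v` is the base of the maximal blossom that contains `v` (it is `v` itself if `v` is odd or
  unlabeled); the nodes of the search structures are the blocks of `base`, and each of them is
  represented by its base;
* `parent v` is the vertex out of which `v` was added; the parent of the node with base `b` is the
  node that contains `parent b`, and the node is a root if `parent b` is undefined. -/
structure SearchState (V : Type*) where
  lcp : V → Option ℕ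
  lcpOdd : V → Option ℕ
  base : V → V
  parent : V → Option V

namespace SearchState

variable {V : Type*}

/-- `v` is a vertex inside an even node. -/
def IsEven (S : SearchState V) (v : V) : Prop := S.lcp v ≠ none

/-- `v` is an odd node: it was born odd and has not become even. -/
def IsOdd (S : SearchState V) (v : V) : Prop := S.lcp v = none ∧ S.lcpOdd v ≠ none

/-- `v` does not belong to the search structures. -/
def IsUnlabeled (S : SearchState V) (v : V) : Prop := S.lcp v = none ∧ S.lcpOdd v = none

/-- `B` is a maximal blossom with base `b`: the set of vertices of an even node. -/
def IsMaximalBlossom (S : SearchState V) (B : Set V) (b : V) : Prop :=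
  S.IsEven b ∧ S.base b = b ∧ B = {v | S.base v = b}

/-- The node (with base) `q` is the parent of the node (with base) `c`. -/
def IsParent (S : SearchState V) (c q : V) : Prop :=
  ∃ w, S.parent c = some w ∧ S.base w = q

/-- The node `a` is an ancestor of the node `c`, where each node is an ancestor of itself. -/
def IsAncestor (S : SearchState V) (c a : V) : Prop :=
  Relation.ReflTransGen S.IsParent c a

/-- The vertices `x` and `y` belong to the same tree, i.e. their nodes have a common ancestor. -/
def SameTree (S : SearchState V) (x y : V) : Prop :=
  ∃ a, S.IsAncestor (S.base x) a ∧ S.IsAncestor (S.base y) a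

/-- The node `b` is the lowest common ancestor of the nodes that contain `x` and `y`. -/
def IsLowestCommonAncestor (S : SearchState V) (x y b : V) : Prop :=
  S.IsAncestor (S.base x) b ∧ S.IsAncestor (S.base y) b ∧
    ∀ a, S.IsAncestor (S.base x) a → S.IsAncestor (S.base y) a → S.IsAncestor b a

/-- The node `c` lies on the tree path from the node containing `x` up to the node `b`, or on the
one from the node containing `y` up to `b`. -/
def OnCycle (S : SearchState V) (x y b c : V) : Prop :=
  (S.IsAncestor (S.base x) c ∨ S.IsAncestor (S.base y) c) ∧ S.IsAncestor c b

/-- The initial state: every free vertex is the root, at level zero, of a search structure. -/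
noncomputable def init {G : SimpleGraph V} (M : G.Subgraph) : SearchState V :=
  open scoped Classical in
  { lcp := fun v => if IsFree M v then some 0 else none
    lcpOdd := fun _ => none
    base := id
    parent := fun _ => none }

/-- The result of growing out of the vertex `u`, whose lcp-value is `k`: the vertex `v` becomes an
odd child of the node containing `u`, and `w` (the mate of `v`) becomes an even child of `v`. -/
noncomputable def grow (S : SearchState V) (u v w : V) (k : ℕ) : SearchState V :=
  open scoped Classical in
  { lcp := Function.update S.lcp w (some (k + 2))
    lcpOdd := Function.update S.lcpOdd v (some (k + 1))
    base := S.base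
    parent := Function.update (Function.update S.parent v (some u)) w (some v) }

/-- The result of adding a bridge `x y` with lcp-sum `m` whose endpoints lie in the same tree, where
`b` is the lowest common ancestor: all nodes on the cycle are merged into one blossom with base
`b`, and every odd node `z` on the cycle becomes even with lcp-value `m + 1 - lcpOdd z`. -/
noncomputable def shrink (S : SearchState V) (x y b : V) (m : ℕ) : SearchState V :=
  open scoped Classical in
  { lcp := fun z => if S.IsOdd z ∧ S.OnCycle x y b z
      then (S.lcpOdd z).map (fun l => m + 1 - l) else S.lcp z
    lcpOdd := S.lcpOdd
    base := fun z => if S.OnCycle x y b (S.base z) then b else S.base z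
    parent := S.parent }

/-- One growth-step of phase `Δ`. Growth-steps occur only in even phases. -/
def GrowthStep {G : SimpleGraph V} (M : G.Subgraph) (Δ : ℕ) (S T : SearchState V) : Prop :=
  Even Δ ∧ ∃ u v w k, S.lcp u = some k ∧ k + 2 = Δ ∧ G.Adj u v ∧ S.IsUnlabeled v ∧ M.Adj v w ∧
    T = S.grow u v w k

/-- In the state `S`, the non-matching edge `x y` has even endpoints in different maximal blossoms
and satisfies `lcp x + lcp y = 2 * Δ - 2`. -/
def IsBridge {G : SimpleGraph V} (M : G.Subgraph) (Δ : ℕ) (S : SearchState V) (x y : V) : Prop :=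
  G.Adj x y ∧ ¬ M.Adj x y ∧ S.base x ≠ S.base y ∧
    ∃ i j, S.lcp x = some i ∧ S.lcp y = some j ∧ i + j + 2 = 2 * Δ

/-- One bridge-step of phase `Δ` that forms a blossom. -/
def BlossomStep {G : SimpleGraph V} (M : G.Subgraph) (Δ : ℕ) (S T : SearchState V) : Prop :=
  ∃ x y b i j, IsBridge M Δ S x y ∧ S.lcp x = some i ∧ S.lcp y = some j ∧
    S.IsLowestCommonAncestor x y b ∧ T = S.shrink x y b (i + j)

/-- The growth-steps of phase `Δ`, performed until none is possible, lead from `S` to `T`. -/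
def GrowthPart {G : SimpleGraph V} (M : G.Subgraph) (Δ : ℕ) (S T : SearchState V) : Prop :=
  Relation.ReflTransGen (GrowthStep M Δ) S T ∧ ∀ T', ¬ GrowthStep M Δ T T'

/-- The bridge-steps of phase `Δ`, performed until no bridge is left, lead from `S` to `T`, and none
of them completes an augmenting path (so that phase `Δ` is not the last one). -/
def BridgePart {G : SimpleGraph V} (M : G.Subgraph) (Δ : ℕ) (S T : SearchState V) : Prop :=
  Relation.ReflTransGen (BlossomStep M Δ) S T ∧ ∀ x y, ¬ IsBridge M Δ T x y

/-- After the growth-steps of phase `Δ` have led to the state `S`, the bridge-steps of the phase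
lead, after some blossoms have been formed, to a bridge between different trees. -/
def Breakthrough {G : SimpleGraph V} (M : G.Subgraph) (Δ : ℕ) (S : SearchState V) : Prop :=
  ∃ T x y, Relation.ReflTransGen (BlossomStep M Δ) S T ∧ IsBridge M Δ T x y ∧ ¬ T.SameTree x y

/-- Some execution, starting from the matching `M`, completes the phases `0, …, Δ` without finding
an augmenting path and is in the state `S` at the end of phase `Δ`. -/
inductive EndOfPhase {G : SimpleGraph V} (M : G.Subgraph) : ℕ → SearchState V → Prop
  | zero : EndOfPhase M 0 (init M)
  | succ {Δ : ℕ} {S U T : SearchState V} : EndOfPhase M Δ S → GrowthPart M (Δ + 1) S U →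
      BridgePart M (Δ + 1) U T → EndOfPhase M (Δ + 1) T

end SearchState

/-!
The proof is by linear programming duality. Give the matching edges weight two and all other edges
weight zero. In phase `Δ`, let `y v` be `1 + lcp v - Δ` for an even vertex, `Δ - lcpOdd v` for an odd
vertex, and `1` for an unlabeled vertex (`SearchState.dualValue`), and let `z u v` be twice the
number of earlier phases at whose end `u` and `v` belonged to the same node. The steps of a phase do
not change `y`, and the transition to the next phase is the dual adjustment of the weighted matching
algorithm. Since a phase ends only when no growth-step and no bridge is left, the adjustment keeps
`y u + y v + z u v` nonnegative on non-matching edges and at most two on matching edges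
(`SearchState.DualFeasible.adjust`).

Nonnegativity on non-matching edges between different blossoms, the absence of bridges, and parity
give `lcp u + lcp v ≥ 2 * Δ` at the end of phase `Δ` (`SearchState.Invariant.lcp_add_lcp`). A vertex
`v` that becomes even in phase `Δ` has `lcp v = 2 * Δ - 1 - lcpOdd v`, and its mate lies in the
same blossom; this gives the first claim.

For the second claim, subtract the sum of `y u + y v + z u v` over the matching edges of an augmenting
path from the sum over its non-matching edges. The vertex terms telescope to the values `1 - Δ` of
the two free endpoints, hence the length is at least `2 * Δ - 1` minus the alternating sum of `z`
(`SearchState.DualFeasible.le_length`). Every vertex of a blossom except its base is matched inside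
the blossom. So the alternating sum of `z` is at most zero, and a blossom that the path meets without
passing through its base makes it negative (`alternatingSum_block`). Such a path is longer than
`2 * Δ - 1`. On the other hand, the bridge of the breakthrough completes an augmenting path of
length exactly `2 * Δ - 1` (`SearchState.Invariant.exists_augmentingPath`): every even vertex `v` is
the end of an alternating path of length `lcp v` inside its tree
(`SearchState.HasCanonicalPath`). These paths persist through bridge-steps because the path of `v`
enters each odd ancestor `z` after `lcpOdd z` steps and then stays among the descendants of `z`, so
that its final part, reversed, can be appended to the path of the other end of the bridge.
-/

/-! ### Alternating lists of edges -/

/-- The edges of the list alternately belong and do not belong to `M`; the first edge belongs to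
`M` exactly if `b` is true. -/
def Alternates {V : Type*} {G : SimpleGraph V} (M : G.Subgraph) : Bool → List (Sym2 V) → Prop
  | _, [] => True
  | b, e :: l => (e ∈ M.edgeSet ↔ b = true) ∧ Alternates M (!b) l

section Alternation

variable {V : Type*} {G : SimpleGraph V} {M : G.Subgraph}

theorem alternates_append {b : Bool} {l₁ l₂ : List (Sym2 V)} :
    Alternates M b (l₁ ++ l₂) ↔
      Alternates M b l₁ ∧ Alternates M (b ^^ l₁.length.bodd) l₂ := by
  induction l₁ generalizing b with
  | nil => simp [Alternates]
  | cons e l ih => simp [Alternates, ih, and_assoc]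

theorem Alternates.reverse {b : Bool} {l : List (Sym2 V)} (h : Alternates M b l) :
    Alternates M (b ^^ !l.length.bodd) l.reverse := by
  induction l generalizing b with
  | nil => trivial
  | cons e l ih =>
    have := ih h.2
    rw [List.reverse_cons, alternates_append]
    refine ⟨?_, ?_, trivial⟩
    · simpa using this
    · simpa using h.1

theorem Alternates.isChain {b : Bool} {l : List (Sym2 V)} (h : Alternates M b l) :
    l.IsChain (fun e f => e ∈ M.edgeSet ↔ f ∉ M.edgeSet) := by
  induction l generalizing b with
  | nil => exact .nil
  | cons e l ih =>
    cases l with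
    | nil => exact .singleton _
    | cons f l =>
      refine .cons_cons ?_ (ih h.2)
      rw [h.1, h.2.1]
      simp

theorem alternates_of_isChain {b : Bool} {l : List (Sym2 V)}
    (h : l.IsChain (fun e f => e ∈ M.edgeSet ↔ f ∉ M.edgeSet))
    (hb : ∀ e ∈ l.head?, e ∈ M.edgeSet ↔ b = true) : Alternates M b l := by
  induction l generalizing b with
  | nil => trivial
  | cons e l ih =>
    have he := hb e rfl
    refine ⟨he, ih h.tail ?_⟩
    intro f hf
    cases l with
    | nil => simp at hf
    | cons f' l =>
      simp only [List.head?_cons, Option.mem_some_iff] at hf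
      subst hf
      have := h.rel
      rw [he] at this
      by_cases hf' : f' ∈ M.edgeSet <;> simp_all

theorem IsAugmentingPath.alternates {s t : V} {p : G.Walk s t} (hp : IsAugmentingPath M p) :
    Alternates M false p.edges := by
  refine alternates_of_isChain hp.alternating ?_
  cases p with
  | nil => simp
  | cons h p =>
    simp only [SimpleGraph.Walk.edges_cons, List.head?_cons, Option.mem_some_iff]
    rintro e rfl
    simpa using hp.free_left _

/-- Two alternating paths are linked by a non-matching edge: the first path ends and the second one
starts with a matching edge. -/
theorem alternates_link {u v x y : V} {p : G.Walk u v} {q : G.Walk x y} (h : G.Adj v x)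
    (hM : ¬ M.Adj v x) (hp : Alternates M false p.edges) (he : Even p.length)
    (hq : Alternates M true q.edges) :
    Alternates M false (p.append (.cons h q)).edges := by
  have hb : p.length.bodd = false := by
    obtain ⟨m, hm⟩ := he
    simp [hm, Nat.bodd_add]
  rw [SimpleGraph.Walk.edges_append, alternates_append]
  refine ⟨hp, ?_⟩
  simp [Alternates, hM, hq, hb]

theorem isPath_link {u v x y : V} {p : G.Walk u v} {q : G.Walk x y} (h : G.Adj v x)
    (hp : p.IsPath) (hq : q.IsPath) (hd : ∀ a ∈ p.support, a ∉ q.support) :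
    (p.append (.cons h q)).IsPath := by
  rw [SimpleGraph.Walk.isPath_def] at *
  rw [SimpleGraph.Walk.support_append, SimpleGraph.Walk.support_cons, List.tail_cons,
    List.nodup_append]
  exact ⟨hp, hq, fun a ha b hb e => hd a ha (e ▸ hb)⟩

theorem Alternates.reverse_of_even {u v : V} {p : G.Walk u v} (hp : Alternates M false p.edges)
    (he : Even p.length) : Alternates M true p.reverse.edges := by
  have := hp.reverse
  obtain ⟨m, hm⟩ := he
  simpa [hm, Nat.bodd_add] using this

/-- Each inner vertex of an alternating walk is covered by a matching edge of the walk. -/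
theorem Alternates.mem_or_exists_matching_edge {u t : V} {p : G.Walk u t} {b : Bool}
    (hp : Alternates M b p.edges) (x : V) (hx : x ∈ p.support) :
    x = u ∨ x = t ∨ ∃ w, M.Adj x w ∧ s(x, w) ∈ p.edges := by
  induction p generalizing b with
  | nil => left; simpa using hx
  | @cons u v t h p ih =>
    rcases List.mem_cons.1 hx with rfl | hx
    · exact .inl rfl
    · obtain ⟨h1, h2⟩ := hp
      rcases ih h2 hx with rfl | rfl | ⟨w, hw, hm⟩
      · cases p with
        | nil => exact .inr (.inl rfl)
        | @cons _ w _ h' p =>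
          right; right
          cases b with
          | true => exact ⟨u, by simpa [SimpleGraph.Subgraph.adj_comm] using h1,
              by simp [Sym2.eq_swap]⟩
          | false => exact ⟨w, by simpa using h2.1, by simp⟩
      · exact .inr (.inl rfl)
      · exact .inr (.inr ⟨w, hw, by simp [hm]⟩)

/-! ### Alternating sums along walks -/

/-- The sum of `g` over the non-matching edges of the walk minus the sum of `g` over its matching
edges. -/
noncomputable def alternatingSum (M : G.Subgraph) (g : V → V → ℤ) {u v : V} (p : G.Walk u v) : ℤ :=
  open scoped Classical in
  (p.darts.map fun d => if M.Adj d.fst d.snd then - g d.fst d.snd else g d.fst d.snd).sum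

theorem alternatingSum_add (g h : V → V → ℤ) {u v : V} (p : G.Walk u v) :
    alternatingSum M (fun a b => g a b + h a b) p = alternatingSum M g p + alternatingSum M h p := by
  rw [alternatingSum, alternatingSum, alternatingSum, ← List.sum_map_add]
  congr 2
  ext d
  split_ifs <;> ring

theorem alternatingSum_finset_sum {ι : Type*} (s : Finset ι) (g : ι → V → V → ℤ) {u v : V}
    (p : G.Walk u v) :
    alternatingSum M (fun a b => ∑ i ∈ s, g i a b) p = ∑ i ∈ s, alternatingSum M (g i) p := by
  classical
  induction s using Finset.induction_on with
  | empty => simp [alternatingSum]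
  | insert i s hi ih =>
    simp only [Finset.sum_insert hi]
    rw [alternatingSum_add, ih]

/-- The alternating sum of `f a + f b` over the edges `ab` of an alternating walk telescopes. -/
theorem alternatingSum_vertex (f : V → ℤ) {u t : V} (p : G.Walk u t) {b : Bool}
    (hp : Alternates M b p.edges) (ht : IsFree M t) (hn : ¬ p.Nil) :
    alternatingSum M (fun a b => f a + f b) p = (if b then - f u else f u) + f t := by
  induction p generalizing b with
  | nil => simp at hn
  | @cons u v t h p ih =>
    obtain ⟨h1, h2⟩ := hp
    change M.Adj u v ↔ b = true at h1
    cases p with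
    | nil =>
      have hM : ¬ M.Adj u v := fun h => ht _ h.symm
      have hb : b = false := by simpa [hM] using h1
      simp [alternatingSum, hM, hb]
    | cons h' p =>
      have := ih h2 ht (by simp)
      unfold alternatingSum at this ⊢
      rw [SimpleGraph.Walk.darts_cons, List.map_cons, List.sum_cons, this]
      cases b <;> simp at h1 <;> simp [h1]; ring

/-- The non-matching edges of an alternating walk meet each visited position at most once. -/
theorem sum_nonmatching_le_sum_support (f : V → ℤ) (hf : ∀ v, 0 ≤ f v) {u t : V} (p : G.Walk u t)
    {b : Bool} (hp : Alternates M b p.edges) :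
    open scoped Classical in
    (p.darts.map fun d => if M.Adj d.fst d.snd then 0 else f d.fst + f d.snd).sum ≤
      (if b then (p.support.tail.map f).sum else (p.support.map f).sum) := by
  induction p generalizing b with
  | nil => cases b <;> simp [hf]
  | @cons u v t h p ih =>
    obtain ⟨h1, h2⟩ := hp
    change M.Adj u v ↔ b = true at h1
    have := ih h2
    have hs : (p.support.map f).sum = f v + (p.support.tail.map f).sum := by
      rw [← List.sum_cons, ← List.map_cons, SimpleGraph.Walk.cons_tail_support]
    rw [SimpleGraph.Walk.darts_cons, List.map_cons, List.sum_cons]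
    cases b <;> simp at h1 this <;> simp [h1, hs] at this ⊢ <;> linarith

/-- Let `C` be a set of vertices, each of which, except possibly `b`, is matched within `C`. An
augmenting path has at most as many non-matching as matching edges inside `C`, and it has fewer of
them if it meets `C` but avoids `b`. -/
theorem alternatingSum_block (C : Set V) (b : V)
    (hC : ∀ v ∈ C, v ≠ b → ∃ w ∈ C, M.Adj v w) (hM : M.IsMatching) {s t : V} {p : G.Walk s t}
    (hp : IsAugmentingPath M p) :
    open scoped Classical in
    alternatingSum M (fun u v => if u ∈ C ∧ v ∈ C then 1 else 0) p ≤ 0 ∧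
    (b ∉ p.support → (∃ x ∈ C, x ∈ p.support) →
      alternatingSum M (fun u v => if u ∈ C ∧ v ∈ C then 1 else 0) p < 0) := by
  classical
  have hn : ¬ p.Nil := fun h => hp.ne h.eq
  have hmate : ∀ u v, M.Adj u v → u ∈ C → u ≠ b → v ∈ C := by
    intro u v huv hu hub
    obtain ⟨w, hw, huw⟩ := hC u hu hub
    rwa [hM.eq_of_adj_left huv huw]
  have hfree : ∀ v, IsFree M v → v ∈ C → v = b := by
    intro v hv hvC
    by_contra hvb
    obtain ⟨w, _, hw⟩ := hC v hvC hvb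
    exact hv w hw
  -- Compare twice the indicator of the edges inside `C` with a sum of vertex weights.
  set f : V → ℤ := fun v => if v ∈ C ∧ v ≠ b then 1 else 0 with hf
  set e : V → ℤ := fun v => if v = b then 1 else 0 with he
  set g : V → V → ℤ := fun u v => if u ∈ C ∧ v ∈ C then 1 else 0 with hg
  have hfs : f s = 0 := by
    simp only [hf, ite_eq_right_iff]
    exact fun h => absurd (hfree s hp.free_left h.1) h.2
  have hft : f t = 0 := by
    simp only [hf, ite_eq_right_iff]
    exact fun h => absurd (hfree t hp.free_right h.1) h.2
  have htel := alternatingSum_vertex f p hp.alternates hp.free_right hn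
  have hmat : ∀ u v, M.Adj u v → f u + f v ≤ g u v + g u v := by
    intro u v h
    have h1 := hmate u v h
    have h2 := hmate v u h.symm
    simp only [hf, hg]
    by_cases hu : u ∈ C <;> by_cases hv : v ∈ C <;> by_cases hub : u = b <;>
      by_cases hvb : v = b <;> simp [hu, hv, hub, hvb] at h1 h2 ⊢ <;> simp_all
  have hnon : ∀ u v, g u v + g u v ≤ f u + f v + (e u + e v) := by
    intro u v
    simp only [hf, hg, he]
    by_cases hu : u ∈ C <;> by_cases hv : v ∈ C <;> by_cases hub : u = b <;>
      by_cases hvb : v = b <;> simp [hu, hv, hub, hvb] <;> split_ifs <;> simp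
  have hdbl := alternatingSum_add (M := M) g g p
  constructor
  · -- The base accounts for an excess of at most one in twice the sum, so the sum is at most zero.
    have hcount := sum_nonmatching_le_sum_support e (fun v => by simp only [he]; split_ifs <;> simp)
      p hp.alternates
    have hsup : (p.support.map e).sum ≤ 1 := by
      rw [← List.sum_toFinset _ hp.isPath.support_nodup]
      simp only [he, Finset.sum_ite_eq']
      split_ifs <;> simp
    have hle : alternatingSum M (fun a b => g a b + g a b) p ≤
        alternatingSum M (fun a b => f a + f b) p + (p.darts.map fun d =>
          if M.Adj d.fst d.snd then 0 else e d.fst + e d.snd).sum := by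
      unfold alternatingSum
      rw [← List.sum_map_add]
      refine List.sum_le_sum fun d _ => ?_
      split_ifs with h
      · have := hmat _ _ h
        linarith
      · exact hnon _ _
    simp only [Bool.false_eq_true, if_false] at hcount htel
    omega
  · rintro hb ⟨x, hxC, hx⟩
    have hsC : s ∉ C := fun h => hb (hfree s hp.free_left h ▸ p.start_mem_support)
    obtain ⟨d, hd, hd1, hd2⟩ := (p.takeUntil x hx).exists_boundary_dart Cᶜ hsC (by simpa using hxC)
    have hd' := p.darts_takeUntil_subset_darts hx hd
    rw [Set.mem_compl_iff, not_not] at hd2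
    have hne : ∀ d ∈ p.darts, d.fst ≠ b ∧ d.snd ≠ b := fun d hd =>
      ⟨fun h => hb (h ▸ p.dart_fst_mem_support_of_mem_darts hd),
        fun h => hb (h ▸ p.dart_snd_mem_support_of_mem_darts hd)⟩
    -- The path enters `C` through a non-matching edge, at which the estimate is strict.
    have hlt : alternatingSum M (fun a b => g a b + g a b) p <
        alternatingSum M (fun a b => f a + f b) p := by
      unfold alternatingSum
      refine List.sum_lt_sum _ _ (fun d hd => ?_) ⟨d, hd', ?_⟩
      · split_ifs with h
        · have := hmat _ _ h
          linarith
        · simpa [he, hne d hd] using hnon d.fst d.snd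
      · have hdM : ¬ M.Adj d.fst d.snd := fun h =>
          hd1 (hmate _ _ h.symm hd2 (hne d hd').2)
        have := (hne d hd').2
        have hd1' : d.fst ∉ C := hd1
        rw [if_neg hdM, if_neg hdM]
        simp [hf, hg, hd1', hd2, this]
    simp only [Bool.false_eq_true, if_false] at htel
    omega

end Alternation

namespace SearchState

/-! ### Ancestors -/

section Ancestors

variable {V : Type*} {S : SearchState V}

/-- `v` belongs to the search structures. -/
def IsLabeled (S : SearchState V) (v : V) : Prop := ¬ S.IsUnlabeled v

theorem isLabeled_iff {v : V} : S.IsLabeled v ↔ S.IsEven v ∨ S.IsOdd v := by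
  unfold IsLabeled IsUnlabeled IsEven IsOdd
  tauto

theorem IsEven.isLabeled {v : V} (h : S.IsEven v) : S.IsLabeled v := isLabeled_iff.2 (.inl h)

theorem IsOdd.isLabeled {v : V} (h : S.IsOdd v) : S.IsLabeled v := isLabeled_iff.2 (.inr h)

theorem IsOdd.not_isEven {v : V} (h : S.IsOdd v) : ¬ S.IsEven v := fun h' => h' h.1

theorem isEven_of_eq {v : V} {k : ℕ} (h : S.lcp v = some k) : S.IsEven v := by
  simp [IsEven, h]

theorem IsParent.unique {c p q : V} (hp : S.IsParent c p) (hq : S.IsParent c q) : p = q := by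
  obtain ⟨v, hv, rfl⟩ := hp
  obtain ⟨w, hw, rfl⟩ := hq
  rw [hv, Option.some_inj] at hw
  rw [hw]

theorem IsAncestor.refl (c : V) : S.IsAncestor c c := Relation.ReflTransGen.refl

theorem IsAncestor.trans {a b c : V} (h : S.IsAncestor a b) (h' : S.IsAncestor b c) :
    S.IsAncestor a c := Relation.ReflTransGen.trans h h'

theorem IsParent.isAncestor {a b : V} (h : S.IsParent a b) : S.IsAncestor a b :=
  Relation.ReflTransGen.single h

theorem IsAncestor.of_isParent {a b c : V} (h : S.IsAncestor a b) (hp : S.IsParent a c)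
    (hne : a ≠ b) : S.IsAncestor c b := by
  rcases Relation.ReflTransGen.cases_head h with h | ⟨d, hd, hdb⟩
  · exact absurd h hne
  · rwa [hp.unique hd]

end Ancestors

/-! ### The invariant of the search -/

section Invariant

variable {V : Type*} {G : SimpleGraph V} {M : G.Subgraph}

/-- The vertex `v` is reached from a free vertex by an alternating path of even length `k` that
stays in the ancestors of the node of `v`. For each odd ancestor `z`, the path leads to `z` in
`lcpOdd z` steps and stays in the descendants of `z` from there on. -/
def HasCanonicalPath (M : G.Subgraph) (S : SearchState V) (v : V) (k : ℕ) : Prop :=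
  ∃ (f : V) (p : G.Walk f v), IsFree M f ∧ p.IsPath ∧ Alternates M false p.edges ∧ p.length = k ∧
    (∀ u ∈ p.support, S.IsAncestor (S.base v) (S.base u)) ∧
    ∀ z l, S.IsOdd z → S.lcpOdd z = some l → S.IsAncestor (S.base v) z →
      ∃ (q : G.Walk f z) (r : G.Walk z v), p = q.append r ∧ q.length = l ∧
        ∀ u ∈ r.support, S.IsAncestor (S.base u) z

/-- The properties of the search structures in phase `Δ` that each step preserves. -/
structure Invariant (M : G.Subgraph) (Δ : ℕ) (S : SearchState V) : Prop where
  even_lcp : ∀ v k, S.lcp v = some k → Even k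
  odd_lcpOdd : ∀ v l, S.lcpOdd v = some l → Odd l ∧ l + 1 ≤ Δ
  base_base : ∀ v, S.base (S.base v) = S.base v
  isEven_base : ∀ v, S.IsEven v → S.IsEven (S.base v)
  base_eq : ∀ v, ¬ S.IsEven v → S.base v = v
  /-- Each vertex of a blossom other than the base is matched within the blossom. -/
  exists_mate : ∀ v, S.base v ≠ v → ∃ w, M.Adj v w ∧ S.base w = S.base v
  mate_odd : ∀ v w, M.Adj v w → S.IsOdd v → S.IsEven w
  mate_unlabeled : ∀ v w, M.Adj v w → S.IsUnlabeled v → S.IsUnlabeled w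
  lcp_free : ∀ v, IsFree M v → S.lcp v = some 0
  /-- A vertex that was added out of a vertex `p` that is still odd is the mate of `p`. -/
  parent_odd : ∀ c p, S.parent c = some p → S.IsEven p ∨ S.IsOdd p ∧ M.Adj c p
  /-- A blossom is a root with a free base, or the odd mate of its base is its parent. -/
  parent_even : ∀ c, S.IsEven c → S.base c = c →
    (S.parent c = none ∧ IsFree M c) ∨ ∃ p, S.parent c = some p ∧ S.IsOdd p ∧ M.Adj c p
  /-- The parent relation is acyclic. -/
  exists_rank : ∃ r : V → ℕ, ∀ c p, S.parent c = some p → r (S.base p) < r c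
  canonicalPath : ∀ v k, S.lcp v = some k → HasCanonicalPath M S v k

namespace Invariant

variable {Δ : ℕ} {S : SearchState V} (hS : Invariant M Δ S)
include hS

theorem mono {Δ' : ℕ} (h : Δ ≤ Δ') : Invariant M Δ' S :=
  { hS with
    odd_lcpOdd := fun v l hl => ⟨(hS.odd_lcpOdd v l hl).1, (hS.odd_lcpOdd v l hl).2.trans h⟩ }

theorem base_of_isAncestor {v a : V} (h : S.IsAncestor (S.base v) a) : S.base a = a := by
  rcases Relation.ReflTransGen.cases_tail h with h | ⟨c, _, w, _, h⟩
  · rw [h, hS.base_base]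
  · rw [← h, hS.base_base]

theorem isLabeled_base {v : V} (h : S.IsLabeled v) : S.IsLabeled (S.base v) := by
  by_cases he : S.IsEven v
  · exact (hS.isEven_base v he).isLabeled
  · rwa [hS.base_eq v he]

theorem isLabeled_of_isParent {c q : V} (h : S.IsParent c q) : S.IsLabeled q := by
  obtain ⟨w, hw, rfl⟩ := h
  refine hS.isLabeled_base ?_
  rcases hS.parent_odd c w hw with h | h
  · exact h.isLabeled
  · exact h.1.isLabeled

theorem isLabeled_of_isAncestor {c a : V} (h : S.IsAncestor c a) (hc : S.IsLabeled c) :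
    S.IsLabeled a := by
  rcases Relation.ReflTransGen.cases_tail h with h | ⟨d, _, hd⟩
  · rwa [h]
  · exact hS.isLabeled_of_isParent hd

theorem isAncestor_antisymm {a b : V} (hab : S.IsAncestor a b) (hba : S.IsAncestor b a) :
    a = b := by
  obtain ⟨r, hr⟩ := hS.exists_rank
  have key : ∀ a b, S.IsAncestor a b → a = b ∨ r b < r a := by
    intro a b h
    induction h with
    | refl => exact .inl rfl
    | @tail c d _ hcd ih =>
      obtain ⟨w, hw, rfl⟩ := hcd
      have := hr c w hw
      rcases ih with rfl | ih
      · exact .inr this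
      · exact .inr (this.trans ih)
  rcases key a b hab with h | h
  · exact h
  · rcases key b a hba with h' | h'
    · exact h'.symm
    · omega

theorem base_of_isOdd {z : V} (h : S.IsOdd z) : S.base z = z := hS.base_eq z h.not_isEven

/-- The only child of an odd node is its mate. -/
theorem adj_of_isParent_odd {c z : V} (h : S.IsParent c z) (hz : S.IsOdd z) :
    S.parent c = some z ∧ M.Adj c z := by
  obtain ⟨p, hp, rfl⟩ := h
  rcases hS.parent_odd c p hp with h | h
  · exact absurd (hS.isEven_base p h) hz.not_isEven
  · rw [hS.base_of_isOdd h.1]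
    exact ⟨hp, h.2⟩

/-- The child through which a proper odd ancestor is reached. -/
theorem exists_child {c z : V} (h : S.IsAncestor c z) (hne : c ≠ z) (hz : S.IsOdd z) :
    ∃ d, S.IsAncestor c d ∧ S.parent d = some z ∧ M.Adj d z ∧ S.IsParent d z := by
  rcases Relation.ReflTransGen.cases_tail h with h | ⟨d, hd, hdz⟩
  · exact absurd h.symm hne
  · exact ⟨d, hd, (hS.adj_of_isParent_odd hdz hz).1, (hS.adj_of_isParent_odd hdz hz).2, hdz⟩

/-- Even vertices in different blossoms are not matched to each other. -/
theorem base_eq_of_adj (hM : M.IsMatching) {v w : V} (h : M.Adj v w) (hv : S.IsEven v)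
    (hw : S.IsEven w) : S.base v = S.base w := by
  by_cases hvb : S.base v = v
  · rcases hS.parent_even v hv hvb with ⟨_, hf⟩ | ⟨p, _, hp, hvp⟩
    · exact absurd h (hf w)
    · rw [hM.eq_of_adj_left hvp h] at hp
      exact absurd hw hp.not_isEven
  · obtain ⟨w', hw', hb⟩ := hS.exists_mate v hvb
    rw [hM.eq_of_adj_left h hw', hb]

end Invariant

theorem isEven_init {v : V} : (init M).IsEven v ↔ IsFree M v := by
  classical
  simp [IsEven, init]

theorem invariant_init : Invariant M 0 (init M) where
  even_lcp v k h := by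
    simp only [init] at h
    split_ifs at h
    rw [Option.some_inj] at h
    exact h ▸ (Even.zero : Even 0)
  odd_lcpOdd v l h := by simp [init] at h
  base_base v := rfl
  isEven_base v h := h
  base_eq v _ := rfl
  exists_mate v h := absurd rfl h
  mate_odd v w _ h := absurd rfl h.2
  mate_unlabeled v w h _ := by
    have : ¬ IsFree M w := fun hw => hw v h.symm
    exact ⟨by simp [init, this], rfl⟩
  lcp_free v h := by simp [init, h]
  parent_odd c p h := by simp [init] at h
  parent_even c h _ := .inl ⟨rfl, isEven_init.1 h⟩
  exists_rank := ⟨fun _ => 0, fun c p h => by simp [init] at h⟩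
  canonicalPath v k h := by
    have hv := isEven_init.1 (isEven_of_eq h)
    have hk : k = 0 := by simpa [init, hv] using h.symm
    subst hk
    refine ⟨v, .nil, hv, .nil, trivial, rfl, ?_, ?_⟩
    · intro u hu
      rw [SimpleGraph.Walk.support_nil, List.mem_singleton] at hu
      rw [hu]
      exact .refl _
    · intro z l hz
      exact absurd rfl hz.2

/-! ### Growth-steps -/

section Grow

variable {Δ : ℕ} {S : SearchState V} {u v w : V} {k : ℕ}

theorem grow_lcp_of_ne {x : V} (h : x ≠ w) : (S.grow u v w k).lcp x = S.lcp x := by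
  simp [grow, h]

theorem grow_lcpOdd_of_ne {x : V} (h : x ≠ v) : (S.grow u v w k).lcpOdd x = S.lcpOdd x := by
  simp [grow, h]

theorem grow_parent_of_ne {x : V} (h : x ≠ v) (h' : x ≠ w) :
    (S.grow u v w k).parent x = S.parent x := by
  simp [grow, h, h']

theorem grow_isAncestor_iff (hS : Invariant M Δ S) (hv : S.IsUnlabeled v) (hw : S.IsUnlabeled w)
    {c a : V} (hc : S.IsLabeled c) : (S.grow u v w k).IsAncestor c a ↔ S.IsAncestor c a := by
  have hpar : ∀ c q, S.IsLabeled c → ((S.grow u v w k).IsParent c q ↔ S.IsParent c q) := by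
    intro c q hc
    have h1 : c ≠ v := fun h => hc (h ▸ hv)
    have h2 : c ≠ w := fun h => hc (h ▸ hw)
    unfold IsParent
    rw [grow_parent_of_ne h1 h2]
    rfl
  constructor
  · intro h
    induction h with
    | refl => exact .refl _
    | @tail d e _ hde ih =>
      exact Relation.ReflTransGen.tail ih
        ((hpar d e (hS.isLabeled_of_isAncestor ih hc)).1 hde)
  · intro h
    induction h with
    | refl => exact .refl _
    | @tail d e hd hde ih =>
      exact Relation.ReflTransGen.tail ih
        ((hpar d e (hS.isLabeled_of_isAncestor hd hc)).2 hde)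

theorem invariant_grow (hS : Invariant M Δ S) (hM : M.IsMatching) (hu : S.lcp u = some k)
    (hk : k + 2 ≤ Δ) (huv : G.Adj u v) (hv : S.IsUnlabeled v) (hvw : M.Adj v w) :
    Invariant M Δ (S.grow u v w k) := by
  set T := S.grow u v w k with hT
  have hw : S.IsUnlabeled w := hS.mate_unlabeled v w hvw hv
  have hne : v ≠ w := hvw.ne
  have hue : S.IsEven u := isEven_of_eq hu
  have hke : Even k := hS.even_lcp u k hu
  have hul : S.IsLabeled (S.base u) := hS.isLabeled_base hue.isLabeled
  have hbv : S.base v = v := hS.base_eq v (fun h => h hv.1)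
  have hbw : S.base w = w := hS.base_eq w (fun h => h hw.1)
  have hTw : T.lcp w = some (k + 2) := by simp [hT, grow]
  have hTv : T.lcpOdd v = some (k + 1) := by simp [hT, grow]
  have hTpv : T.parent v = some u := by simp [hT, grow, hne]
  have hTpw : T.parent w = some v := by simp [hT, grow]
  have hTodd : T.IsOdd v := ⟨by rw [hT, grow_lcp_of_ne hne, hv.1], by simp [hTv]⟩
  have hEv : ∀ {x}, S.IsEven x → T.IsEven x := by
    intro x hx
    have : x ≠ w := fun h => hx (h ▸ hw.1)
    rwa [IsEven, hT, grow_lcp_of_ne this]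
  have hEv' : ∀ {x}, T.IsEven x → x = w ∨ S.IsEven x := by
    intro x hx
    by_cases h : x = w
    · exact .inl h
    · rw [IsEven, hT, grow_lcp_of_ne h] at hx
      exact .inr hx
  have hOd : ∀ {x}, S.IsOdd x → T.IsOdd x := by
    intro x hx
    have h1 : x ≠ w := fun h => hx.isLabeled (h ▸ hw)
    have h2 : x ≠ v := fun h => hx.isLabeled (h ▸ hv)
    rwa [IsOdd, hT, grow_lcp_of_ne h1, grow_lcpOdd_of_ne h2]
  have hOd' : ∀ {x}, T.IsOdd x → x = v ∨ x ≠ v ∧ S.IsOdd x := by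
    intro x hx
    by_cases h : x = v
    · exact .inl h
    · have h1 : x ≠ w := by
        rintro rfl
        rw [IsOdd, hTw] at hx
        simp at hx
      rw [IsOdd, hT, grow_lcp_of_ne h1, grow_lcpOdd_of_ne h] at hx
      exact .inr ⟨h, hx⟩
  have hAnc : ∀ {c a}, S.IsLabeled c → (T.IsAncestor c a ↔ S.IsAncestor c a) :=
    fun hc => grow_isAncestor_iff hS hv hw hc
  have hwv : T.IsParent w v := ⟨v, hTpw, hbv⟩
  have hvu : T.IsParent v (S.base u) := ⟨u, hTpv, rfl⟩
  constructor
  · intro x i hi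
    by_cases h : x = w
    · subst h
      rw [hTw, Option.some_inj] at hi
      rw [← hi]
      exact hke.add (by decide)
    · rw [hT, grow_lcp_of_ne h] at hi
      exact hS.even_lcp x i hi
  · intro x l hl
    by_cases h : x = v
    · subst h
      rw [hTv, Option.some_inj] at hl
      rw [← hl]
      exact ⟨hke.add_one, hk⟩
    · rw [hT, grow_lcpOdd_of_ne h] at hl
      exact hS.odd_lcpOdd x l hl
  · exact hS.base_base
  · intro x hx
    rcases hEv' hx with rfl | hx
    · change T.IsEven (S.base x)
      rwa [hbw]
    · exact hEv (hS.isEven_base x hx)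
  · exact fun x hx => hS.base_eq x (fun h => hx (hEv h))
  · exact hS.exists_mate
  · intro x y hxy hx
    rcases hOd' hx with rfl | ⟨_, hx⟩
    · rw [← hM.eq_of_adj_left hvw hxy]
      exact isEven_of_eq hTw
    · exact hEv (hS.mate_odd x y hxy hx)
  · intro x y hxy hx
    have h1 : x ≠ w := fun h => by
      rw [h, IsUnlabeled, hTw] at hx
      simp at hx
    have h2 : x ≠ v := fun h => by
      rw [h, IsUnlabeled, hTv] at hx
      simp at hx
    have h3 : y ≠ v := fun h => h1 (hM.eq_of_adj_left (h ▸ hxy.symm) hvw)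
    have h4 : y ≠ w := fun h => h2 (hM.eq_of_adj_right (h ▸ hxy) hvw)
    rw [IsUnlabeled, hT, grow_lcp_of_ne h1, grow_lcpOdd_of_ne h2] at hx
    rw [IsUnlabeled, hT, grow_lcp_of_ne h4, grow_lcpOdd_of_ne h3]
    exact hS.mate_unlabeled x y hxy hx
  · intro x hx
    have h1 : x ≠ w := fun h => hx v (h ▸ hvw.symm)
    rw [hT, grow_lcp_of_ne h1]
    exact hS.lcp_free x hx
  · intro c p hp
    by_cases h : c = w
    · subst h
      rw [hTpw, Option.some_inj] at hp
      rw [← hp]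
      exact .inr ⟨hTodd, hvw.symm⟩
    by_cases h' : c = v
    · subst h'
      rw [hTpv, Option.some_inj] at hp
      rw [← hp]
      exact .inl (hEv hue)
    rw [hT, grow_parent_of_ne h' h] at hp
    rcases hS.parent_odd c p hp with h | h
    · exact .inl (hEv h)
    · exact .inr ⟨hOd h.1, h.2⟩
  · intro c hc hb
    rcases hEv' hc with rfl | hc
    · exact .inr ⟨v, hTpw, hTodd, hvw.symm⟩
    · have h1 : c ≠ w := fun h => hc.isLabeled (h ▸ hw)
      have h2 : c ≠ v := fun h => hc.isLabeled (h ▸ hv)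
      rw [hT, grow_parent_of_ne h2 h1]
      rcases hS.parent_even c hc hb with h | ⟨p, hp, hpo, hcp⟩
      · exact .inl h
      · exact .inr ⟨p, hp, hOd hpo, hcp⟩
  · obtain ⟨r, hr⟩ := hS.exists_rank
    classical
    have hold : ∀ x, S.IsLabeled x →
        Function.update (Function.update r v (r (S.base u) + 1)) w (r (S.base u) + 2) x = r x := by
      intro x hx
      have h1 : x ≠ v := fun h => hx (h ▸ hv)
      have h2 : x ≠ w := fun h => hx (h ▸ hw)
      rw [Function.update_of_ne h2, Function.update_of_ne h1]
    refine ⟨Function.update (Function.update r v (r (S.base u) + 1)) w (r (S.base u) + 2), ?_⟩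
    intro c p hp
    change Function.update (Function.update r v (r (S.base u) + 1)) w (r (S.base u) + 2) (S.base p)
      < _
    by_cases h : c = w
    · subst h
      rw [hTpw, Option.some_inj] at hp
      rw [← hp, hbv, Function.update_of_ne hne]
      simp
    by_cases h' : c = v
    · subst h'
      rw [hTpv, Option.some_inj] at hp
      rw [← hp, hold _ hul, Function.update_of_ne hne]
      simp
    rw [hT, grow_parent_of_ne h' h] at hp
    have hpl : S.IsLabeled (S.base p) := hS.isLabeled_of_isParent ⟨p, hp, rfl⟩
    rw [hold _ hpl, Function.update_of_ne h, Function.update_of_ne h']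
    exact hr c p hp
  · intro x i hi
    by_cases h : x = w
    · subst h
      rw [hTw, Option.some_inj] at hi
      subst hi
      obtain ⟨f, p, hf, hp, halt, hlen, hanc, hsplit⟩ := hS.canonicalPath u k hu
      have hlab : ∀ a ∈ p.support, S.IsLabeled (S.base a) :=
        fun a ha => hS.isLabeled_of_isAncestor (hanc a ha) hul
      have huM : ¬ M.Adj u v := fun h =>
        hue (hS.mate_unlabeled v u h.symm hv).1
      have hd : ∀ a ∈ p.support, a ∉ (SimpleGraph.Walk.cons hvw.adj_sub .nil).support := by
        intro a ha ha'
        rw [SimpleGraph.Walk.support_cons, SimpleGraph.Walk.support_nil, List.mem_cons,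
          List.mem_singleton] at ha'
        rcases ha' with rfl | rfl
        · exact hlab a ha (by rwa [hbv])
        · exact hlab a ha (by rwa [hbw])
      have hwu : T.IsAncestor x (S.base u) := hwv.isAncestor.trans hvu.isAncestor
      refine ⟨f, p.append (.cons huv (.cons hvw.adj_sub .nil)), hf,
        isPath_link huv hp (by simp [hne]) hd,
        alternates_link huv huM halt (hlen ▸ hke) (by simp [Alternates, hvw]), by simp [hlen],
        ?_, ?_⟩
      · intro a ha
        change T.IsAncestor (S.base x) (S.base a)
        rw [SimpleGraph.Walk.support_append] at ha
        simp only [SimpleGraph.Walk.support_cons, SimpleGraph.Walk.support_nil, List.tail_cons,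
          List.mem_append, List.mem_cons, List.not_mem_nil, or_false] at ha
        rw [hbw]
        rcases ha with ha | rfl | rfl
        · exact hwu.trans ((hAnc hul).2 (hanc a ha))
        · rw [hbv]
          exact hwv.isAncestor
        · rw [hbw]
          exact .refl _
      · intro z l hz hl hxz
        change T.IsAncestor (S.base x) z at hxz
        rw [hbw] at hxz
        rcases hOd' hz with rfl | ⟨hzv, hz'⟩
        · rw [hTv, Option.some_inj] at hl
          refine ⟨p.append (.cons huv .nil), .cons hvw.adj_sub .nil, ?_, by simp [hlen, ← hl], ?_⟩
          · rw [← SimpleGraph.Walk.append_assoc]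
            rfl
          · intro a ha
            change T.IsAncestor (S.base a) z
            rw [SimpleGraph.Walk.support_cons, SimpleGraph.Walk.support_nil, List.mem_cons,
              List.mem_singleton] at ha
            rcases ha with rfl | rfl
            · rw [hbv]
              exact .refl _
            · rw [hbw]
              exact hwv.isAncestor
        · have hxz' : x ≠ z := fun h => hz'.isLabeled (h ▸ hw)
          have huz := (hxz.of_isParent hwv hxz').of_isParent hvu (Ne.symm hzv)
          rw [hAnc hul] at huz
          rw [hT, grow_lcpOdd_of_ne hzv] at hl
          obtain ⟨q, r, rfl, hq, hr⟩ := hsplit z l hz' hl huz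
          refine ⟨q, r.append (.cons huv (.cons hvw.adj_sub .nil)), ?_, hq, ?_⟩
          · rw [SimpleGraph.Walk.append_assoc]
          · intro a ha
            change T.IsAncestor (S.base a) z
            rw [SimpleGraph.Walk.support_append] at ha
            simp only [SimpleGraph.Walk.support_cons, SimpleGraph.Walk.support_nil, List.tail_cons,
              List.mem_append, List.mem_cons, List.not_mem_nil, or_false] at ha
            rcases ha with ha | rfl | rfl
            · exact (hAnc (hlab a (by
                rw [SimpleGraph.Walk.mem_support_append_iff]
                exact .inr ha))).2 (hr a ha)
            · rw [hbv]
              exact hvu.isAncestor.trans ((hAnc hul).2 huz)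
            · rw [hbw]
              exact hwu.trans ((hAnc hul).2 huz)
    · rw [hT, grow_lcp_of_ne h] at hi
      obtain ⟨f, p, hf, hp, halt, hlen, hanc, hsplit⟩ := hS.canonicalPath x i hi
      have hxl : S.IsLabeled (S.base x) := hS.isLabeled_base (isEven_of_eq hi).isLabeled
      refine ⟨f, p, hf, hp, halt, hlen, fun a ha => (hAnc hxl).2 (hanc a ha), ?_⟩
      intro z l hz hl hxz
      have hxz' := (hAnc hxl).1 hxz
      have hzl := hS.isLabeled_of_isAncestor hxz' hxl
      have hzv : z ≠ v := fun h => hzl (h ▸ hv)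
      rcases hOd' hz with h | ⟨_, hz'⟩
      · exact absurd h hzv
      rw [hT, grow_lcpOdd_of_ne hzv] at hl
      obtain ⟨q, r, hqr, hq, hr⟩ := hsplit z l hz' hl hxz'
      refine ⟨q, r, hqr, hq, fun a ha => (hAnc ?_).2 (hr a ha)⟩
      refine hS.isLabeled_of_isAncestor (hanc a ?_) hxl
      rw [hqr, SimpleGraph.Walk.mem_support_append_iff]
      exact .inr ha

end Grow

/-! ### Blossom-steps -/

section Shrink

variable {Δ : ℕ} {S : SearchState V} {x y b : V} {i j : ℕ}

open scoped Classical in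
/-- The node of the contracted structure that contains the node `c`. -/
noncomputable def contract (S : SearchState V) (x y b c : V) : V :=
  if S.OnCycle x y b c then b else c

theorem contract_of_onCycle {c : V} (h : S.OnCycle x y b c) : S.contract x y b c = b := if_pos h

theorem contract_of_not {c : V} (h : ¬ S.OnCycle x y b c) : S.contract x y b c = c := if_neg h

theorem shrink_base {m : ℕ} (v : V) :
    (S.shrink x y b m).base v = S.contract x y b (S.base v) := rfl

theorem shrink_lcp_of_onCycle {m l : ℕ} {z : V} (h : S.IsOdd z) (h' : S.OnCycle x y b z)
    (hl : S.lcpOdd z = some l) : (S.shrink x y b m).lcp z = some (m + 1 - l) := by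
  simp [shrink, h, h', hl]

theorem shrink_lcp_of_not {m : ℕ} {z : V} (h : ¬ (S.IsOdd z ∧ S.OnCycle x y b z)) :
    (S.shrink x y b m).lcp z = S.lcp z := by
  simp only [shrink, if_neg h]

theorem shrink_lcp_of_isEven {m : ℕ} {z : V} (h : S.IsEven z) :
    (S.shrink x y b m).lcp z = S.lcp z :=
  shrink_lcp_of_not fun h' => h'.1.not_isEven h

theorem IsLowestCommonAncestor.onCycle (hL : S.IsLowestCommonAncestor x y b) :
    S.OnCycle x y b b := ⟨.inl hL.1, .refl _⟩

theorem IsLowestCommonAncestor.symm (hL : S.IsLowestCommonAncestor x y b) :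
    S.IsLowestCommonAncestor y x b := ⟨hL.2.1, hL.1, fun a h h' => hL.2.2 a h' h⟩

theorem OnCycle.of_isParent {c q : V} (h : S.OnCycle x y b c) (hne : c ≠ b)
    (hp : S.IsParent c q) : S.OnCycle x y b q :=
  ⟨h.1.imp (·.trans hp.isAncestor) (·.trans hp.isAncestor), h.2.of_isParent hp hne⟩

/-- Ancestors in the contracted structure are the images of ancestors. -/
theorem shrink_isAncestor_iff (hb : S.OnCycle x y b b) {m : ℕ} {c a : V} :
    (S.shrink x y b m).IsAncestor (S.contract x y b c) a ↔
      ∃ d, S.contract x y b d = a ∧ S.IsAncestor c d := by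
  constructor
  · intro h
    induction h with
    | refl => exact ⟨c, rfl, .refl _⟩
    | @tail a q _ haq ih =>
      obtain ⟨d, hd, hcd⟩ := ih
      obtain ⟨w, hw, rfl⟩ := haq
      refine ⟨S.base w, rfl, ?_⟩
      by_cases hdC : S.OnCycle x y b d
      · rw [contract_of_onCycle hdC] at hd
        subst hd
        exact (hcd.trans hdC.2).trans (IsParent.isAncestor ⟨w, hw, rfl⟩)
      · rw [contract_of_not hdC] at hd
        subst hd
        exact hcd.trans (IsParent.isAncestor ⟨w, hw, rfl⟩)
  · rintro ⟨d, rfl, hcd⟩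
    induction hcd with
    | refl => exact .refl _
    | @tail d e _ hde ih =>
      refine ih.trans ?_
      by_cases hd : S.OnCycle x y b d
      · rw [contract_of_onCycle hd]
        by_cases hdb : d = b
        · subst hdb
          obtain ⟨w, hw, rfl⟩ := hde
          exact IsParent.isAncestor ⟨w, hw, rfl⟩
        · rw [contract_of_onCycle (hd.of_isParent hdb hde)]
          exact .refl _
      · rw [contract_of_not hd]
        obtain ⟨w, hw, rfl⟩ := hde
        exact IsParent.isAncestor ⟨w, hw, rfl⟩

/-- An odd node has only one child, so it is not the lowest common ancestor of two even nodes. -/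
theorem Invariant.isEven_lca (hS : Invariant M Δ S) (hM : M.IsMatching) (hx : S.IsEven x)
    (hy : S.IsEven y) (hL : S.IsLowestCommonAncestor x y b) : S.IsEven b := by
  have hbx := hS.isEven_base x hx
  have hby := hS.isEven_base y hy
  rcases isLabeled_iff.1 (hS.isLabeled_of_isAncestor hL.1 hbx.isLabeled) with h | h
  · exact h
  · obtain ⟨d, hd, -, hdb, hp⟩ := hS.exists_child hL.1 (fun e => h.not_isEven (e ▸ hbx)) h
    obtain ⟨d', hd', -, hdb', -⟩ := hS.exists_child hL.2.1 (fun e => h.not_isEven (e ▸ hby)) h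
    rw [hM.eq_of_adj_right hdb' hdb] at hd'
    have := hS.isAncestor_antisymm hp.isAncestor (hL.2.2 d hd hd')
    exact absurd this hdb.ne

/-- The mate of an odd node on the cycle lies on the cycle, too. -/
theorem Invariant.exists_child_onCycle (hS : Invariant M Δ S) (hx : S.IsEven x)
    (hy : S.IsEven y) {z : V} (hz : S.IsOdd z) (h : S.OnCycle x y b z) :
    ∃ d, S.OnCycle x y b d ∧ S.base d = d ∧ M.Adj d z := by
  rcases h with ⟨h | h, hzb⟩
  · obtain ⟨d, hd, -, hdz, hp⟩ := hS.exists_child h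
      (fun e => hz.not_isEven (e ▸ hS.isEven_base x hx)) hz
    exact ⟨d, ⟨.inl hd, hp.isAncestor.trans hzb⟩, hS.base_of_isAncestor hd, hdz⟩
  · obtain ⟨d, hd, -, hdz, hp⟩ := hS.exists_child h
      (fun e => hz.not_isEven (e ▸ hS.isEven_base y hy)) hz
    exact ⟨d, ⟨.inr hd, hp.isAncestor.trans hzb⟩, hS.base_of_isAncestor hd, hdz⟩

/-- The canonical path of `y`, the bridge, and the final part of the canonical path of `x` in
reverse form an alternating path to any odd node `z` between `x` and the lowest common ancestor. -/
theorem Invariant.exists_path_around (hS : Invariant M Δ S) (hM : M.IsMatching)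
    (hxy : G.Adj x y) (hnM : ¬ M.Adj x y) (hx : S.lcp x = some i) (hy : S.lcp y = some j)
    (hL : S.IsLowestCommonAncestor x y b) {z : V} {l : ℕ} (hz : S.IsOdd z)
    (hl : S.lcpOdd z = some l) (hxz : S.IsAncestor (S.base x) z) (hzb : S.IsAncestor z b) :
    ∃ (f : V) (p : G.Walk f z), IsFree M f ∧ p.IsPath ∧ Alternates M false p.edges ∧
      p.length + l = i + j + 1 ∧
      (∀ a ∈ p.support, S.IsAncestor (S.base x) (S.base a) ∨ S.IsAncestor (S.base y) (S.base a)) ∧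
      ∀ z' l', S.IsOdd z' → S.lcpOdd z' = some l' → S.IsAncestor b z' →
        ∃ (q : G.Walk f z') (r : G.Walk z' z), p = q.append r ∧ q.length = l' ∧
          ∀ a ∈ r.support, S.IsAncestor (S.base a) z' := by
  obtain ⟨f, p, -, hp, hpalt, hplen, hpanc, hps⟩ := hS.canonicalPath x i hx
  obtain ⟨g, p', hg, hp', hpalt', hplen', hpanc', hps'⟩ := hS.canonicalPath y j hy
  obtain ⟨q, r, rfl, hq, hr⟩ := hps z l hz hl hxz
  have hbE := hS.isEven_lca hM (isEven_of_eq hx) (isEven_of_eq hy) hL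
  have hd : ∀ a ∈ p'.support, a ∉ r.reverse.support := by
    intro a ha ha'
    rw [SimpleGraph.Walk.support_reverse, List.mem_reverse] at ha'
    have h1 := hpanc a (by
      rw [SimpleGraph.Walk.mem_support_append_iff]
      exact .inr ha')
    have h2 := hL.2.2 _ h1 (hpanc' a ha)
    have h3 := hS.isAncestor_antisymm hzb (h2.trans (hr a ha'))
    exact hz.not_isEven (h3 ▸ hbE)
  have hralt : Alternates M true r.reverse.edges := by
    have h1 := hpalt.reverse_of_even (hplen ▸ hS.even_lcp x i hx)
    rw [SimpleGraph.Walk.reverse_append, SimpleGraph.Walk.edges_append, alternates_append] at h1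
    exact h1.1
  refine ⟨g, p'.append (.cons hxy.symm r.reverse), hg,
    isPath_link hxy.symm hp' hp.of_append_right.reverse hd,
    alternates_link hxy.symm (fun h => hnM h.symm) hpalt' (hplen' ▸ hS.even_lcp y j hy) hralt,
    ?_, ?_, ?_⟩
  · rw [SimpleGraph.Walk.length_append] at hplen
    rw [SimpleGraph.Walk.length_append, SimpleGraph.Walk.length_cons,
      SimpleGraph.Walk.length_reverse]
    omega
  · intro a ha
    rw [SimpleGraph.Walk.support_append, SimpleGraph.Walk.support_cons, List.tail_cons,
      List.mem_append, SimpleGraph.Walk.support_reverse, List.mem_reverse] at ha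
    rcases ha with ha | ha
    · exact .inr (hpanc' a ha)
    · refine .inl (hpanc a ?_)
      rw [SimpleGraph.Walk.mem_support_append_iff]
      exact .inr ha
  · intro z' l' hz' hl' hbz'
    obtain ⟨q', r', rfl, hq', hr'⟩ := hps' z' l' hz' hl' (hL.2.1.trans hbz')
    refine ⟨q', r'.append (.cons hxy.symm r.reverse), ?_, hq', ?_⟩
    · rw [SimpleGraph.Walk.append_assoc]
    · intro a ha
      rw [SimpleGraph.Walk.support_append, SimpleGraph.Walk.support_cons, List.tail_cons,
        List.mem_append, SimpleGraph.Walk.support_reverse, List.mem_reverse] at ha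
      rcases ha with ha | ha
      · exact hr' a ha
      · exact ((hr a ha).trans hzb).trans hbz'

theorem invariant_shrink (hS : Invariant M Δ S) (hM : M.IsMatching) (hxy : G.Adj x y)
    (hnM : ¬ M.Adj x y) (hx : S.lcp x = some i) (hy : S.lcp y = some j) (hij : i + j + 2 = 2 * Δ)
    (hL : S.IsLowestCommonAncestor x y b) : Invariant M Δ (S.shrink x y b (i + j)) := by
  set T := S.shrink x y b (i + j) with hT
  have hxE := isEven_of_eq hx
  have hyE := isEven_of_eq hy
  have hbE := hS.isEven_lca hM hxE hyE hL
  have hbC := hL.onCycle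
  have hbb : S.base b = b := hS.base_of_isAncestor hL.1
  have hCbase : ∀ {c}, S.OnCycle x y b c → S.base c = c := by
    rintro c ⟨h | h, -⟩ <;> exact hS.base_of_isAncestor h
  have hClab : ∀ {c}, S.OnCycle x y b c → S.IsLabeled c := by
    rintro c ⟨h | h, -⟩
    · exact hS.isLabeled_of_isAncestor h (hS.isEven_base x hxE).isLabeled
    · exact hS.isLabeled_of_isAncestor h (hS.isEven_base y hyE).isLabeled
  have hEv : ∀ {v}, S.IsEven v → T.IsEven v := fun h => by
    rwa [IsEven, hT, shrink_lcp_of_isEven h]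
  have hCE : ∀ {v}, S.OnCycle x y b v → T.IsEven v := by
    intro v hv
    rcases isLabeled_iff.1 (hClab hv) with h | h
    · exact hEv h
    · obtain ⟨l, hl⟩ := Option.ne_none_iff_exists'.1 h.2
      exact isEven_of_eq (shrink_lcp_of_onCycle h hv hl)
  have hEv' : ∀ {v}, T.IsEven v → ¬ S.OnCycle x y b v → S.IsEven v := fun h h' => by
    rwa [IsEven, hT, shrink_lcp_of_not (fun h => h' h.2)] at h
  have hOd : ∀ {v}, S.IsOdd v → ¬ S.OnCycle x y b v → T.IsOdd v := fun h h' => by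
    rw [IsOdd, hT, shrink_lcp_of_not (fun h => h' h.2)]
    exact h
  have hOd' : ∀ {v}, T.IsOdd v → S.IsOdd v ∧ ¬ S.OnCycle x y b v := by
    intro v hv
    have hC : ¬ S.OnCycle x y b v := fun h => hv.not_isEven (hCE h)
    rw [IsOdd, hT, shrink_lcp_of_not (fun h => hC h.2)] at hv
    exact ⟨hv, hC⟩
  have hUn : ∀ {v}, T.IsUnlabeled v ↔ S.IsUnlabeled v := by
    intro v
    by_cases hC : S.OnCycle x y b v
    · exact iff_of_false (hCE hC).isLabeled (hClab hC)
    · rw [IsUnlabeled, hT, shrink_lcp_of_not (fun h => hC h.2)]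
      rfl
  have hTb : ∀ v, T.base v = S.contract x y b (S.base v) := fun v => rfl
  have hAnc : ∀ {v a}, T.IsAncestor (T.base v) a ↔
      ∃ d, S.contract x y b d = a ∧ S.IsAncestor (S.base v) d :=
    fun {v a} => shrink_isAncestor_iff hbC
  have hodd_le : ∀ {z l}, S.lcpOdd z = some l → l ≤ i + j + 1 := by
    intro z l hl
    have := (hS.odd_lcpOdd z l hl).2
    omega
  have hmateC : ∀ {c p}, S.OnCycle x y b p → S.IsOdd p → M.Adj c p → S.OnCycle x y b c := by
    intro c p hp hpo hcp
    obtain ⟨d, hd, -, hdp⟩ := hS.exists_child_onCycle hxE hyE hpo hp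
    rwa [hM.eq_of_adj_right hcp hdp]
  constructor
  · intro v k hk
    by_cases h : S.IsOdd v ∧ S.OnCycle x y b v
    · obtain ⟨l, hl⟩ := Option.ne_none_iff_exists'.1 h.1.2
      rw [hT, shrink_lcp_of_onCycle h.1 h.2 hl, Option.some_inj] at hk
      obtain ⟨i', hi'⟩ := hS.even_lcp x i hx
      obtain ⟨j', hj'⟩ := hS.even_lcp y j hy
      obtain ⟨⟨l', hl'⟩, -⟩ := hS.odd_lcpOdd v l hl
      have := hodd_le hl
      exact ⟨i' + j' - l', by omega⟩
    · rw [hT, shrink_lcp_of_not h] at hk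
      exact hS.even_lcp v k hk
  · exact hS.odd_lcpOdd
  · intro v
    rw [hTb, hTb]
    by_cases h : S.OnCycle x y b (S.base v)
    · rw [contract_of_onCycle h, hbb, contract_of_onCycle hbC]
    · rw [contract_of_not h, hS.base_base, contract_of_not h]
  · intro v hv
    rw [hTb]
    by_cases h : S.OnCycle x y b (S.base v)
    · rw [contract_of_onCycle h]
      exact hEv hbE
    · rw [contract_of_not h]
      refine hEv (hS.isEven_base v (hEv' hv fun hC => h ?_))
      rwa [hCbase hC]
  · intro v hv
    have h := hS.base_eq v (fun h => hv (hEv h))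
    rw [hTb, h, contract_of_not (fun h => hv (hCE h))]
  · intro v hv
    rw [hTb] at hv ⊢
    by_cases h : S.OnCycle x y b (S.base v)
    · rw [contract_of_onCycle h] at hv ⊢
      by_cases hvb : S.base v = v
      · rw [hvb] at h
        rcases isLabeled_iff.1 (hClab h) with hvE | hvO
        · rcases hS.parent_even v hvE hvb with ⟨hp, -⟩ | ⟨p, hp, hpo, hvp⟩
          · rcases Relation.ReflTransGen.cases_head h.2 with h' | ⟨d, ⟨w, hw, -⟩, -⟩
            · exact absurd h'.symm hv
            · rw [hp] at hw
              exact absurd hw (by simp)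
          · refine ⟨p, hvp, ?_⟩
            have hpp := hS.base_of_isOdd hpo
            rw [hTb, hpp, contract_of_onCycle (h.of_isParent (Ne.symm hv) ⟨p, hp, hpp⟩)]
        · obtain ⟨d, hd, hdb, hdv⟩ := hS.exists_child_onCycle hxE hyE hvO h
          exact ⟨d, hdv.symm, by rw [hTb, hdb, contract_of_onCycle hd]⟩
      · obtain ⟨w, hvw, hw⟩ := hS.exists_mate v hvb
        exact ⟨w, hvw, by rw [hTb, hw, contract_of_onCycle h]⟩
    · rw [contract_of_not h] at hv ⊢
      obtain ⟨w, hvw, hw⟩ := hS.exists_mate v hv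
      exact ⟨w, hvw, by rw [hTb, hw, contract_of_not h]⟩
  · exact fun v w hvw hv => hEv (hS.mate_odd v w hvw (hOd' hv).1)
  · intro v w hvw hv
    rw [hUn] at hv ⊢
    exact hS.mate_unlabeled v w hvw hv
  · intro v hv
    have := hS.lcp_free v hv
    rwa [hT, shrink_lcp_of_isEven (isEven_of_eq this)]
  · intro c p hp
    rcases hS.parent_odd c p hp with h | ⟨h, hcp⟩
    · exact .inl (hEv h)
    · by_cases hC : S.OnCycle x y b p
      · exact .inl (hCE hC)
      · exact .inr ⟨hOd h hC, hcp⟩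
  · intro c hc hcb
    rw [hTb] at hcb
    by_cases h : c = b
    · subst h
      rcases hS.parent_even c hbE hbb with h | ⟨p, hp, hpo, hcp⟩
      · exact .inl h
      · refine .inr ⟨p, hp, hOd hpo fun hC => ?_, hcp⟩
        have hcp' : S.IsParent c p := ⟨p, hp, hS.base_of_isOdd hpo⟩
        exact hcp.ne (hS.isAncestor_antisymm hcp'.isAncestor hC.2)
    · have hC : ¬ S.OnCycle x y b (S.base c) := fun hC => by
        rw [contract_of_onCycle hC] at hcb
        exact h hcb.symm
      rw [contract_of_not hC] at hcb
      rw [hcb] at hC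
      rcases hS.parent_even c (hEv' hc hC) hcb with h | ⟨p, hp, hpo, hcp⟩
      · exact .inl h
      · exact .inr ⟨p, hp, hOd hpo fun hpC => hC (hmateC hpC hpo hcp), hcp⟩
  · obtain ⟨r, hr⟩ := hS.exists_rank
    have hle : ∀ {a c}, S.IsAncestor a c → r c ≤ r a := by
      intro a c h
      induction h with
      | refl => exact le_rfl
      | @tail d e _ hde ih =>
        obtain ⟨w, hw, rfl⟩ := hde
        exact (hr d w hw).le.trans ih
    refine ⟨r, fun c p hp => ?_⟩
    have := hr c p hp
    rw [hTb]
    by_cases h : S.OnCycle x y b (S.base p)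
    · rw [contract_of_onCycle h]
      exact (hle h.2).trans_lt this
    · rwa [contract_of_not h]
  · intro v k hk
    -- an odd ancestor in the new structure is an odd ancestor outside of the cycle in the old one
    have hold : ∀ {v z}, T.IsOdd z → T.IsAncestor (T.base v) z → S.IsAncestor (S.base v) z := by
      intro v z hz hvz
      obtain ⟨d, hd, hvd⟩ := hAnc.1 hvz
      by_cases hC : S.OnCycle x y b d
      · rw [contract_of_onCycle hC] at hd
        exact absurd (hd ▸ hbE) (hOd' hz).1.not_isEven
      · rw [contract_of_not hC] at hd
        rwa [← hd]
    have hnew : ∀ {v z}, T.IsOdd z → S.IsAncestor (S.base v) z → T.IsAncestor (T.base v) z :=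
      fun hz h => hAnc.2 ⟨_, contract_of_not (hOd' hz).2, h⟩
    by_cases h : S.IsOdd v ∧ S.OnCycle x y b v
    · obtain ⟨hvO, hvC⟩ := h
      obtain ⟨l, hl⟩ := Option.ne_none_iff_exists'.1 hvO.2
      rw [hT, shrink_lcp_of_onCycle hvO hvC hl, Option.some_inj] at hk
      have hvb : S.base v = v := hS.base_of_isOdd hvO
      have hTv : T.base v = T.base b := by
        rw [hTb, hTb, hvb, hbb, contract_of_onCycle hvC, contract_of_onCycle hbC]
      have hpath : ∃ (f : V) (p : G.Walk f v), IsFree M f ∧ p.IsPath ∧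
          Alternates M false p.edges ∧ p.length + l = i + j + 1 ∧
          (∀ a ∈ p.support,
            S.IsAncestor (S.base x) (S.base a) ∨ S.IsAncestor (S.base y) (S.base a)) ∧
          ∀ z' l', S.IsOdd z' → S.lcpOdd z' = some l' → S.IsAncestor b z' →
            ∃ (q : G.Walk f z') (r : G.Walk z' v), p = q.append r ∧ q.length = l' ∧
              ∀ a ∈ r.support, S.IsAncestor (S.base a) z' := by
        rcases hvC with ⟨h | h, hvb⟩
        · exact hS.exists_path_around hM hxy hnM hx hy hL hvO hl h hvb
        · obtain ⟨f, p, h1, h2, h3, h4, h5, h6⟩ := hS.exists_path_around hM hxy.symm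
            (fun h => hnM h.symm) hy hx hL.symm hvO hl h hvb
          exact ⟨f, p, h1, h2, h3, by omega, fun a ha => (h5 a ha).symm, h6⟩
      obtain ⟨f, p, hf, hp, halt, hlen, hanc, hsplit⟩ := hpath
      refine ⟨f, p, hf, hp, halt, by omega, ?_, ?_⟩
      · intro a ha
        rw [hTv]
        have hxb : T.base x = T.base b := by
          rw [hTb, hTb, hbb, contract_of_onCycle hbC, contract_of_onCycle ⟨.inl (.refl _), hL.1⟩]
        have hyb : T.base y = T.base b := by
          rw [hTb, hTb, hbb, contract_of_onCycle hbC, contract_of_onCycle ⟨.inr (.refl _), hL.2.1⟩]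
        rcases hanc a ha with h | h
        · rw [← hxb]
          exact hAnc.2 ⟨_, rfl, h⟩
        · rw [← hyb]
          exact hAnc.2 ⟨_, rfl, h⟩
      · intro z l' hz hl' hvz
        rw [hTv] at hvz
        have hbz := hold hz hvz
        rw [hbb] at hbz
        obtain ⟨q, r, hqr, hq, hr⟩ := hsplit z l' (hOd' hz).1 hl' hbz
        exact ⟨q, r, hqr, hq, fun a ha => hnew hz (hr a ha)⟩
    · rw [hT, shrink_lcp_of_not h] at hk
      obtain ⟨f, p, hf, hp, halt, hlen, hanc, hsplit⟩ := hS.canonicalPath v k hk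
      refine ⟨f, p, hf, hp, halt, hlen, fun a ha => hAnc.2 ⟨_, rfl, hanc a ha⟩, ?_⟩
      intro z l hz hl hvz
      obtain ⟨q, r, hqr, hq, hr⟩ := hsplit z l (hOd' hz).1 hl (hold hz hvz)
      exact ⟨q, r, hqr, hq, fun a ha => hnew hz (hr a ha)⟩

end Shrink

/-! ### The augmenting path found at the breakthrough -/

theorem Invariant.exists_augmentingPath {Δ : ℕ} {S : SearchState V} {x y : V}
    (hS : Invariant M Δ S) (hxy : IsBridge M Δ S x y) (hT : ¬ S.SameTree x y) :
    ∃ (s t : V) (p : G.Walk s t), IsAugmentingPath M p ∧ p.length + 1 = 2 * Δ := by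
  obtain ⟨hadj, hnM, -, i, j, hi, hj, hij⟩ := hxy
  obtain ⟨f, p, hf, hp, halt, hlen, hanc, -⟩ := hS.canonicalPath x i hi
  obtain ⟨g, q, hg, hq, halt', hlen', hanc', -⟩ := hS.canonicalPath y j hj
  have hd : ∀ a ∈ p.support, a ∉ q.reverse.support := fun a ha ha' => by
    rw [SimpleGraph.Walk.support_reverse, List.mem_reverse] at ha'
    exact hT ⟨_, hanc a ha, hanc' a ha'⟩
  refine ⟨f, g, p.append (.cons hadj q.reverse), ⟨isPath_link hadj hp hq.reverse hd, ?_, hf, hg,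
    (alternates_link hadj hnM halt (hlen ▸ hS.even_lcp x i hi)
      (halt'.reverse_of_even (hlen' ▸ hS.even_lcp y j hj))).isChain⟩, ?_⟩
  · rintro rfl
    exact hd f p.start_mem_support q.reverse.end_mem_support
  · rw [SimpleGraph.Walk.length_append, SimpleGraph.Walk.length_cons,
      SimpleGraph.Walk.length_reverse]
    omega

/-! ### Dual values -/

/-- The value of the vertex `v` in phase `Δ` in the linear program dual to the search for a matching
of maximum weight, where matching edges have weight two and all other edges weight zero. -/
def dualValue (S : SearchState V) (Δ : ℕ) (v : V) : ℤ :=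
  match S.lcp v, S.lcpOdd v with
  | some k, _ => 1 + k - Δ
  | none, some l => Δ - l
  | none, none => 1

section DualValue

variable {S : SearchState V} {Δ : ℕ} {v : V}

theorem dualValue_even {k : ℕ} (h : S.lcp v = some k) : S.dualValue Δ v = 1 + k - Δ := by
  simp [dualValue, h]

theorem dualValue_odd {l : ℕ} (h : S.lcp v = none) (hl : S.lcpOdd v = some l) :
    S.dualValue Δ v = Δ - l := by
  simp [dualValue, h, hl]

theorem dualValue_unlabeled (h : S.IsUnlabeled v) : S.dualValue Δ v = 1 := by
  simp [dualValue, h.1, h.2]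

theorem dualValue_congr {T : SearchState V} (h : T.lcp v = S.lcp v) (h' : T.lcpOdd v = S.lcpOdd v) :
    T.dualValue Δ v = S.dualValue Δ v := by
  rw [dualValue, dualValue, h, h']

/-- The change of the dual value from one phase to the next. -/
theorem dualValue_succ (S : SearchState V) (Δ : ℕ) (v : V) :
    (S.IsEven v ∧ S.dualValue (Δ + 1) v = S.dualValue Δ v - 1) ∨
    (S.IsOdd v ∧ S.dualValue (Δ + 1) v = S.dualValue Δ v + 1) ∨
    (S.IsUnlabeled v ∧ S.dualValue (Δ + 1) v = S.dualValue Δ v) := by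
  unfold IsEven IsOdd IsUnlabeled dualValue
  cases h : S.lcp v with
  | some k => simp; ring
  | none =>
    cases h' : S.lcpOdd v with
    | some l => simp; ring
    | none => simp

end DualValue

/-- The values `z u v`, where `z u v` stands for the total dual value of the blossoms that contain
both `u` and `v`, complete the dual values of the vertices in phase `Δ` to a feasible dual solution.
Besides, `z` vanishes between different nodes, and its alternating sum is at most zero on each
augmenting path. -/
structure DualFeasible (M : G.Subgraph) (Δ : ℕ) (S : SearchState V) (z : V → V → ℤ) : Prop where
  nonneg : ∀ u v, G.Adj u v → ¬ M.Adj u v → 0 ≤ S.dualValue Δ u + S.dualValue Δ v + z u v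
  le_two : ∀ u v, M.Adj u v → S.dualValue Δ u + S.dualValue Δ v + z u v ≤ 2
  eq_zero : ∀ u v, S.base u ≠ S.base v → z u v = 0
  sum_nonpos : ∀ (s t : V) (p : G.Walk s t), IsAugmentingPath M p → alternatingSum M z p ≤ 0

/-- Every vertex adjacent to an even vertex of level `Δ - 2` is labeled. -/
def Saturated (G : SimpleGraph V) (Δ : ℕ) (S : SearchState V) : Prop :=
  ∀ u v k, S.lcp u = some k → k + 2 = Δ → G.Adj u v → S.IsLabeled v

theorem dualFeasible_init : DualFeasible M 0 (init M) fun _ _ => 0 := by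
  have h1 : ∀ v, (init M).dualValue 0 v = 1 := by
    intro v
    by_cases h : IsFree M v
    · rw [dualValue_even (invariant_init.lcp_free v h)]
      simp
    · exact dualValue_unlabeled ⟨by simp [init, h], rfl⟩
  refine ⟨fun u v _ _ => ?_, fun u v _ => ?_, fun _ _ _ => rfl, fun s t p _ => ?_⟩
  · rw [h1, h1]
    norm_num
  · rw [h1, h1]
    norm_num
  · simp [alternatingSum]

theorem DualFeasible.of_dualValue_eq {Δ : ℕ} {S T : SearchState V} {z : V → V → ℤ}
    (h : DualFeasible M Δ S z) (hy : ∀ v, T.dualValue Δ v = S.dualValue Δ v)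
    (hb : ∀ u v, S.base u = S.base v → T.base u = T.base v) : DualFeasible M Δ T z where
  nonneg u v := by
    rw [hy, hy]
    exact h.nonneg u v
  le_two u v := by
    rw [hy, hy]
    exact h.le_two u v
  eq_zero u v huv := h.eq_zero u v fun e => huv (hb u v e)
  sum_nonpos := h.sum_nonpos

/-- Dual values change only from one phase to the next, not in a growth-step. -/
theorem dualValue_grow {Δ : ℕ} {S : SearchState V} {u v w : V} {k : ℕ} (hk : k + 2 = Δ)
    (hvw : v ≠ w) (hv : S.IsUnlabeled v) (hw : S.IsUnlabeled w) (x : V) :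
    (S.grow u v w k).dualValue Δ x = S.dualValue Δ x := by
  by_cases h : x = w
  · subst h
    rw [dualValue_unlabeled hw, dualValue_even (k := k + 2) (by simp [grow])]
    push_cast [← hk]
    ring
  · by_cases h' : x = v
    · subst h'
      rw [dualValue_unlabeled hv, dualValue_odd (l := k + 1) (by rw [grow_lcp_of_ne h, hv.1])
        (by simp [grow])]
      push_cast [← hk]
      ring
    · exact dualValue_congr (grow_lcp_of_ne h) (grow_lcpOdd_of_ne h')

/-- Dual values do not change in a bridge-step: the lcp-value of a vertex that becomes even is chosen
such that the odd and the even dual value agree. -/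
theorem Invariant.dualValue_shrink {Δ : ℕ} {S : SearchState V} (hS : Invariant M Δ S) {x y b : V}
    {m : ℕ} (hm : m + 2 = 2 * Δ) (v : V) :
    (S.shrink x y b m).dualValue Δ v = S.dualValue Δ v := by
  by_cases h : S.IsOdd v ∧ S.OnCycle x y b v
  · obtain ⟨l, hl⟩ := Option.ne_none_iff_exists'.1 h.1.2
    have := (hS.odd_lcpOdd v l hl).2
    rw [dualValue_even (shrink_lcp_of_onCycle h.1 h.2 hl), dualValue_odd h.1.1 hl]
    omega
  · exact dualValue_congr (shrink_lcp_of_not h) rfl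

theorem Invariant.saturated_shrink {Δ : ℕ} {S : SearchState V} (hS : Invariant M Δ S) {x y b : V}
    {m : ℕ} (hm : m + 2 = 2 * Δ) (h : Saturated G Δ S) : Saturated G Δ (S.shrink x y b m) := by
  intro u v k hu hk huv hv
  have hv' : S.IsUnlabeled v := by
    have : ¬ S.IsOdd v := fun h => h.2 hv.2
    exact ⟨by rw [← shrink_lcp_of_not (fun h => this h.1)]; exact hv.1, hv.2⟩
  by_cases hC : S.IsOdd u ∧ S.OnCycle x y b u
  · obtain ⟨l, hl⟩ := Option.ne_none_iff_exists'.1 hC.1.2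
    have := (hS.odd_lcpOdd u l hl).2
    rw [shrink_lcp_of_onCycle hC.1 hC.2 hl, Option.some_inj] at hu
    omega
  · rw [shrink_lcp_of_not hC] at hu
    exact h u v k hu hk huv hv'

/-- Once no bridge is left, a non-matching edge between different blossoms has lcp-sum at least
`2 * Δ`: it is not tight, and all lcp-values are even. -/
theorem Invariant.lcp_add_lcp {Δ : ℕ} {S : SearchState V} {z : V → V → ℤ} (hS : Invariant M Δ S)
    (hD : DualFeasible M Δ S z) (hB : ∀ x y, ¬ IsBridge M Δ S x y) {u v : V} {i j : ℕ}
    (hu : S.lcp u = some i) (hv : S.lcp v = some j) (huv : G.Adj u v) (hnM : ¬ M.Adj u v)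
    (hb : S.base u ≠ S.base v) : 2 * Δ ≤ i + j := by
  have h1 := hD.nonneg u v huv hnM
  rw [dualValue_even hu, dualValue_even hv, hD.eq_zero u v hb] at h1
  have h2 : i + j + 2 ≠ 2 * Δ := fun h => hB u v ⟨huv, hnM, hb, i, j, hu, hv, h⟩
  obtain ⟨i', hi'⟩ := hS.even_lcp u i hu
  obtain ⟨j', hj'⟩ := hS.even_lcp v j hv
  omega

/-- On every augmenting path, at most as many non-matching as matching edges join vertices of the
same node. There are fewer of them if the path meets a node without passing through its base. -/
theorem Invariant.alternatingSum_base [Finite V] {Δ : ℕ} {S : SearchState V}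
    (hS : Invariant M Δ S) (hM : M.IsMatching) {s t : V} {p : G.Walk s t}
    (hp : IsAugmentingPath M p) :
    open scoped Classical in
    alternatingSum M (fun u v => if S.base u = S.base v then 1 else 0) p ≤ 0 ∧
    ∀ b, b ∉ p.support → (∃ x, S.base x = b ∧ x ∈ p.support) →
      alternatingSum M (fun u v => if S.base u = S.base v then 1 else 0) p < 0 := by
  classical
  have := Fintype.ofFinite V
  have hblock := fun c : V => alternatingSum_block {v | S.base v = c} c (by
    intro v hv hvc
    obtain ⟨w, hvw, hw⟩ := hS.exists_mate v (fun h => hvc (h.symm.trans hv))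
    exact ⟨w, hw.trans hv, hvw⟩) hM hp
  have hsum : (fun u v => if S.base u = S.base v then (1 : ℤ) else 0) =
      fun u v => ∑ c : V, if u ∈ {v | S.base v = c} ∧ v ∈ {v | S.base v = c} then (1 : ℤ) else 0 := by
    ext u v
    simp only [Set.mem_ofPred_eq, ite_and, Finset.sum_ite_eq, Finset.mem_univ, if_true]
    simp only [eq_comm]
  rw [hsum, alternatingSum_finset_sum]
  refine ⟨Finset.sum_nonpos fun c _ => (hblock c).1, fun b hb hx => ?_⟩
  exact Finset.sum_neg' (fun c _ => (hblock c).1) ⟨b, Finset.mem_univ b, (hblock b).2 hb hx⟩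

open scoped Classical in
/-- The values of the blossoms after the dual adjustment at the end of a phase: the value of each
maximal blossom grows by two. The other nodes are single vertices and contain no edges, so evenness
need not be tested. -/
noncomputable def adjust (S : SearchState V) (z : V → V → ℤ) (u v : V) : ℤ :=
  z u v + ((if S.base u = S.base v then 1 else 0) + (if S.base u = S.base v then 1 else 0))

theorem alternatingSum_adjust (S : SearchState V) (z : V → V → ℤ) {s t : V} (p : G.Walk s t) :
    open scoped Classical in
    alternatingSum M (S.adjust z) p = alternatingSum M z p +
      2 * alternatingSum M (fun u v => if S.base u = S.base v then 1 else 0) p := by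
  rw [two_mul, ← alternatingSum_add, ← alternatingSum_add]
  rfl

/-- The dual adjustment keeps the solution feasible: it would overshoot only at a tight edge that
permits a growth-step or is a bridge, and the phase has performed all of these. -/
theorem DualFeasible.adjust [Finite V] {Δ : ℕ} {S : SearchState V} {z : V → V → ℤ}
    (hD : DualFeasible M Δ S z) (hS : Invariant M Δ S) (hM : M.IsMatching)
    (hsat : Saturated G Δ S) (hB : ∀ x y, ¬ IsBridge M Δ S x y) :
    DualFeasible M (Δ + 1) S (S.adjust z) := by
  have hadj : ∀ u v, S.base u ≠ S.base v → S.adjust z u v = 0 := fun u v h => by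
    rw [SearchState.adjust, if_neg h, hD.eq_zero u v h]
    rfl
  have hadj' : ∀ u v, S.base u = S.base v → S.adjust z u v = z u v + 2 := fun u v h => by
    rw [SearchState.adjust, if_pos h]
    rfl
  have hbase : ∀ u v, ¬ S.IsEven v → u ≠ v → S.base u ≠ S.base v := by
    intro u v hv huv h
    by_cases hu : S.IsEven u
    · have := hS.isEven_base u hu
      rw [h, hS.base_eq v hv] at this
      exact hv this
    · rw [hS.base_eq u hu, hS.base_eq v hv] at h
      exact huv h
  -- an even and an unlabeled vertex
  have hEU : ∀ u v, G.Adj u v → ¬ M.Adj u v → S.IsEven u → S.IsUnlabeled v →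
      1 ≤ S.dualValue Δ u + S.dualValue Δ v := by
    intro u v huv hnM hu hv
    obtain ⟨k, hk⟩ := Option.ne_none_iff_exists'.1 hu
    have h1 := hD.nonneg u v huv hnM
    rw [hD.eq_zero u v (hbase u v (fun h => h hv.1) huv.ne)] at h1
    rw [dualValue_even hk, dualValue_unlabeled hv] at h1 ⊢
    have : k + 2 ≠ Δ := fun h => hsat u v k hk h huv hv
    omega
  refine ⟨fun u v huv hnM => ?_, fun u v huv => ?_, hadj, fun s t p hp => ?_⟩
  · have h1 := hD.nonneg u v huv hnM
    by_cases hb : S.base u = S.base v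
    · rw [hadj' u v hb]
      rcases dualValue_succ S Δ u with ⟨_, hu⟩ | ⟨_, hu⟩ | ⟨_, hu⟩ <;>
      rcases dualValue_succ S Δ v with ⟨_, hv⟩ | ⟨_, hv⟩ | ⟨_, hv⟩ <;> omega
    · rw [hadj u v hb]
      rw [hD.eq_zero u v hb] at h1
      rcases dualValue_succ S Δ u with ⟨hu', hu⟩ | ⟨hu', hu⟩ | ⟨hu', hu⟩ <;>
      rcases dualValue_succ S Δ v with ⟨hv', hv⟩ | ⟨hv', hv⟩ | ⟨hv', hv⟩ <;> try omega
      · obtain ⟨i, hi⟩ := Option.ne_none_iff_exists'.1 hu'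
        obtain ⟨j, hj⟩ := Option.ne_none_iff_exists'.1 hv'
        have := hS.lcp_add_lcp hD hB hi hj huv hnM hb
        rw [dualValue_even hi] at hu ⊢
        rw [dualValue_even hj] at hv ⊢
        omega
      · have := hEU u v huv hnM hu' hv'
        omega
      · have := hEU v u huv.symm (fun h => hnM h.symm) hv' hu'
        omega
  · have h1 := hD.le_two u v huv
    by_cases hb : S.base u = S.base v
    · have hu : S.IsEven u := by
        by_contra h
        exact hbase v u h huv.ne.symm hb.symm
      have hv : S.IsEven v := by
        by_contra h
        exact hbase u v h huv.ne hb
      rw [hadj' u v hb]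
      rcases dualValue_succ S Δ u with ⟨_, hu'⟩ | ⟨h, _⟩ | ⟨h, _⟩
      · rcases dualValue_succ S Δ v with ⟨_, hv'⟩ | ⟨h, _⟩ | ⟨h, _⟩
        · omega
        · exact absurd hv h.not_isEven
        · exact absurd h.1 hv
      · exact absurd hu h.not_isEven
      · exact absurd h.1 hu
    · rw [hadj u v hb]
      rw [hD.eq_zero u v hb] at h1
      rcases dualValue_succ S Δ u with ⟨_, hu⟩ | ⟨hu', hu⟩ | ⟨hu', hu⟩
      · rcases dualValue_succ S Δ v with ⟨_, hv⟩ | ⟨_, hv⟩ | ⟨_, hv⟩ <;> omega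
      · have hvE := hS.mate_odd u v huv hu'
        rcases dualValue_succ S Δ v with ⟨_, hv⟩ | ⟨h, _⟩ | ⟨h, _⟩
        · omega
        · exact absurd hvE h.not_isEven
        · exact absurd h.1 hvE
      · have hvU := hS.mate_unlabeled u v huv hu'
        rcases dualValue_succ S Δ v with ⟨_, hv⟩ | ⟨h, _⟩ | ⟨h, hv⟩
        · omega
        · exact absurd hvU.2 h.2
        · omega
  · rw [alternatingSum_adjust]
    have := hD.sum_nonpos s t p hp
    have := (hS.alternatingSum_base hM hp).1
    omega

/-- Weak duality: a lower bound on the length of augmenting paths. -/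
theorem DualFeasible.le_length {Δ : ℕ} {S : SearchState V} {z : V → V → ℤ}
    (hD : DualFeasible M Δ S z) (hS : Invariant M Δ S) {s t : V} {p : G.Walk s t}
    (hp : IsAugmentingPath M p) : (2 * Δ - 1 - alternatingSum M z p : ℤ) ≤ p.length := by
  have hn : ¬ p.Nil := fun h => hp.ne h.eq
  -- `2 * (y u + y v + z u v) - 2` is at least `-2` on non-matching and at most `2` on matching edges
  have h1 := alternatingSum_vertex (fun v => 2 * S.dualValue Δ v - 1) p hp.alternates
    hp.free_right hn
  have h2 := alternatingSum_add (M := M) z z p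
  have h3 := alternatingSum_add (M := M)
    (fun u v => (2 * S.dualValue Δ u - 1) + (2 * S.dualValue Δ v - 1)) (fun u v => z u v + z u v) p
  have h4 : (p.length : ℤ) * (-2) ≤ alternatingSum M (fun u v =>
      ((2 * S.dualValue Δ u - 1) + (2 * S.dualValue Δ v - 1)) + (z u v + z u v)) p := by
    classical
    unfold alternatingSum
    rw [← p.length_darts, ← List.length_map (as := p.darts)
      (f := fun d => if M.Adj d.fst d.snd then
        -(((2 * S.dualValue Δ d.fst - 1) + (2 * S.dualValue Δ d.snd - 1)) +
          (z d.fst d.snd + z d.fst d.snd)) else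
        ((2 * S.dualValue Δ d.fst - 1) + (2 * S.dualValue Δ d.snd - 1)) +
          (z d.fst d.snd + z d.fst d.snd)), ← nsmul_eq_mul]
    refine List.card_nsmul_le_sum _ _ fun a ha => ?_
    obtain ⟨d, -, rfl⟩ := List.mem_map.1 ha
    split_ifs with h
    · have := hD.le_two _ _ h
      omega
    · have := hD.nonneg _ _ d.adj h
      omega
  simp only [Bool.false_eq_true, if_false, dualValue_even (hS.lcp_free s hp.free_left),
    dualValue_even (hS.lcp_free t hp.free_right)] at h1
  push_cast at h1
  omega

/-! ### Executions -/

theorem Invariant.of_growthSteps {Δ : ℕ} {S U : SearchState V} {z : V → V → ℤ}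
    (hM : M.IsMatching) (hS : Invariant M Δ S) (hD : DualFeasible M Δ S z)
    (h : Relation.ReflTransGen (GrowthStep M Δ) S U) :
    Invariant M Δ U ∧ DualFeasible M Δ U z := by
  induction h with
  | refl => exact ⟨hS, hD⟩
  | tail _ h ih =>
    obtain ⟨hS, hD⟩ := ih
    obtain ⟨-, u, v, w, k, hu, hk, huv, hv, hvw, rfl⟩ := h
    exact ⟨invariant_grow hS hM hu hk.le huv hv hvw,
      hD.of_dualValue_eq (dualValue_grow hk hvw.ne hv (hS.mate_unlabeled v w hvw hv)) fun _ _ h => h⟩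

theorem Invariant.saturated {Δ : ℕ} {S : SearchState V} (hS : Invariant M Δ S)
    (h : ∀ T, ¬ GrowthStep M Δ S T) : Saturated G Δ S := by
  intro u v k hu hk huv hv
  have hf : ¬ IsFree M v := fun hf => isEven_of_eq (hS.lcp_free v hf) hv.1
  simp only [IsFree, not_forall, not_not] at hf
  obtain ⟨w, hvw⟩ := hf
  refine h _ ⟨?_, u, v, w, k, hu, hk, huv, hv, hvw, rfl⟩
  rw [← hk]
  exact (hS.even_lcp u k hu).add (by decide)

theorem Invariant.of_blossomSteps {Δ : ℕ} {U T : SearchState V} {z : V → V → ℤ}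
    (hM : M.IsMatching) (hU : Invariant M Δ U) (hD : DualFeasible M Δ U z)
    (hsat : Saturated G Δ U) (h : Relation.ReflTransGen (BlossomStep M Δ) U T) :
    Invariant M Δ T ∧ DualFeasible M Δ T z ∧ Saturated G Δ T := by
  induction h with
  | refl => exact ⟨hU, hD, hsat⟩
  | tail _ h ih =>
    obtain ⟨hS, hD, hsat⟩ := ih
    obtain ⟨x, y, b, i, j, ⟨hxy, hnM, -, i', j', hi', hj', hij⟩, hi, hj, hL, rfl⟩ := h
    rw [hi, Option.some_inj] at hi'
    rw [hj, Option.some_inj] at hj'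
    subst hi' hj'
    refine ⟨invariant_shrink hS hM hxy hnM hi hj hij hL,
      hD.of_dualValue_eq (hS.dualValue_shrink hij) ?_,
      hS.saturated_shrink hij hsat⟩
    intro u v huv
    rw [shrink_base, shrink_base, huv]

/-- An odd vertex that becomes even in phase `Δ` gets the lcp-value `2 * Δ - 1 - lcpOdd`. -/
theorem lcp_of_blossomSteps {Δ : ℕ} {U T : SearchState V} (hU : Invariant M Δ U)
    (h : Relation.ReflTransGen (BlossomStep M Δ) U T) {v : V} {l : ℕ} (hv : U.IsOdd v)
    (hl : U.lcpOdd v = some l) :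
    T.lcpOdd v = some l ∧ (T.IsOdd v ∨ ∃ k, T.lcp v = some k ∧ k + l + 1 = 2 * Δ) := by
  have hlΔ := (hU.odd_lcpOdd v l hl).2
  induction h with
  | refl => exact ⟨hl, .inl hv⟩
  | @tail S _ _ h ih =>
    obtain ⟨hl, ih⟩ := ih
    obtain ⟨x, y, b, i, j, ⟨-, -, -, i', j', hi', hj', hij⟩, hi, hj, -, rfl⟩ := h
    rw [hi, Option.some_inj] at hi'
    rw [hj, Option.some_inj] at hj'
    subst hi' hj'
    refine ⟨hl, ?_⟩
    rcases ih with ho | ⟨k, hk, hkl⟩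
    · by_cases hC : S.OnCycle x y b v
      · exact .inr ⟨_, shrink_lcp_of_onCycle ho hC hl, by omega⟩
      · refine .inl ⟨?_, ho.2⟩
        rw [shrink_lcp_of_not fun h => hC h.2]
        exact ho.1
    · refine .inr ⟨k, ?_, hkl⟩
      rw [shrink_lcp_of_isEven (isEven_of_eq hk)]
      exact hk

theorem EndOfPhase.exists_dual [Finite V] (hM : M.IsMatching) {Δ : ℕ} {S : SearchState V}
    (h : EndOfPhase M Δ S) :
    ∃ z, Invariant M Δ S ∧ DualFeasible M Δ S z ∧ Saturated G Δ S ∧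
      ∀ x y, ¬ IsBridge M Δ S x y := by
  induction h with
  | zero =>
    refine ⟨_, invariant_init, dualFeasible_init, ?_, ?_⟩
    · rintro u v k - hk
      omega
    · rintro x y ⟨-, -, -, i, j, -, -, hij⟩
      omega
  | succ _ hU hT ih =>
    obtain ⟨z, hS, hD, hsat, hB⟩ := ih
    obtain ⟨hU', hD'⟩ := (hS.mono (Nat.le_succ _)).of_growthSteps hM
      (hD.adjust hS hM hsat hB) hU.1
    obtain ⟨h1, h2, h3⟩ := hU'.of_blossomSteps hM hD' (hU'.saturated hU.2) hT.1
    exact ⟨_, h1, h2, h3, hT.2⟩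

end Invariant

end SearchState

theorem mainTheorem3 {V : Type*} [Finite V] (G : SimpleGraph V) (M : G.Subgraph)
    (hM : M.IsMatching) (Δ : ℕ) (hΔ : 1 ≤ Δ) (S U : SearchState V)
    (hS : SearchState.EndOfPhase M (Δ - 1) S) (hU : SearchState.GrowthPart M Δ S U) :
    -- `T` is the state at the end of phase `Δ`, which is not the last phase
    (∀ T : SearchState V, SearchState.BridgePart M Δ U T →
      -- `v` is an odd node that becomes even in phase `Δ`
      ∀ v : V, U.IsOdd v → T.IsEven v →
        ∃ l : ℕ, T.lcpOdd v = some l ∧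
          ∃ (B : Set V) (b : V), T.IsMaximalBlossom B b ∧ v ∈ B ∧
            (¬ ∃ u : V, u ∉ B ∧ G.Adj u v ∧ ∃ k : ℕ, T.lcp u = some k ∧ l = k + 1) ∧
            (∀ u : V, u ∉ B → G.Adj u v → ∀ k : ℕ, T.lcp u = some k → l + 1 ≤ k)) ∧
    -- the breakthrough occurs in phase `Δ`
    (SearchState.Breakthrough M Δ U →
      ∀ (B : Set V) (b : V), S.IsMaximalBlossom B b →
        ∀ (s t : V) (p : G.Walk s t), IsShortestAugmentingPath M p →
          (∃ x ∈ B, x ∈ p.support) →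
            b = s ∨ b = t ∨ ∃ w : V, M.Adj b w ∧ s(b, w) ∈ p.edges) := by
  obtain ⟨Δ, rfl⟩ := Nat.exists_eq_succ_of_ne_zero (Nat.one_le_iff_ne_zero.1 hΔ)
  obtain ⟨z, hSI, hSD, hsat, hB⟩ := hS.exists_dual hM
  have hSI' := hSI.mono (Nat.le_succ Δ)
  have hSD' := hSD.adjust hSI hM hsat hB
  obtain ⟨hUI, hUD⟩ := hSI'.of_growthSteps hM hSD' hU.1
  have hUsat := hUI.saturated hU.2
  constructor
  · intro T hT v hvO hvE
    obtain ⟨hTI, hTD, -⟩ := hUI.of_blossomSteps hM hUD hUsat hT.1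
    obtain ⟨l, hl⟩ := Option.ne_none_iff_exists'.1 hvO.2
    obtain ⟨hTl, hv⟩ := SearchState.lcp_of_blossomSteps hUI hT.1 hvO hl
    have key : ∀ u : V, u ∉ {u | T.base u = T.base v} → G.Adj u v →
        ∀ k : ℕ, T.lcp u = some k → l + 1 ≤ k := by
      intro u hu huv k hk
      rcases hv with hv | ⟨j, hj, hjl⟩
      · exact absurd hvE hv.not_isEven
      · have hnM : ¬ M.Adj u v := fun h =>
          hu (hTI.base_eq_of_adj hM h (SearchState.isEven_of_eq hk) hvE)
        have := hTI.lcp_add_lcp hTD hT.2 hk hj huv hnM hu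
        omega
    refine ⟨l, hTl, _, T.base v, ⟨hTI.isEven_base v hvE, hTI.base_base v, rfl⟩, rfl, ?_, key⟩
    rintro ⟨u, hu, huv, k, hk, hlk⟩
    have := key u hu huv k hk
    omega
  · rintro ⟨T, x, y, hT, hxy, hne⟩ B b ⟨-, -, rfl⟩ s t p hp ⟨a, haB, ha⟩
    obtain ⟨hTI, -, -⟩ := hUI.of_blossomSteps hM hUD hUsat hT
    obtain ⟨s', t', q, hq, hlen⟩ := hTI.exists_augmentingPath hxy hne
    have hpA := hp.isAugmentingPath
    refine hpA.alternates.mem_or_exists_matching_edge b ?_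
    by_contra hb
    have h1 := (hSI.alternatingSum_base hM hpA).2 b hb ⟨a, haB, ha⟩
    have h2 := hSD.sum_nonpos s t p hpA
    have h3 := hSD'.le_length hSI' hpA
    rw [SearchState.alternatingSum_adjust] at h3
    have h4 := hp.shortest s' t' q hq
    push_cast at h3
    omega
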